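/- Let $(M,\omega)$ be a symplectic manifold (Hausdorff, second countable, not necessarily connected), let $(L,\nabla)\to M$ be a prequantum line bundle, i.e. a Hermitian complex line bundle with compatible connection whose curvature is $\omega$ (normalized so that a local frame $s$ with $\nabla_X s=i\theta(X)s$ has $d\theta=\omega$), let $P\subset TM$ be a singular real polarization (a smooth singular subbundle whose sheaf of sections is involutive and locally finitely generated, and which is Lagrangian on a dense open set), and let $\Phi:M\to M$ be a symplectomorphism. Put $\Phi(P)_x=(\Phi^{-1})_*(P_{\Phi(x)})$. A leaf of $P$ is a maximal connected injectively immersed integral submanifold $\iota:B\to M$ of $P$, up to diffeomorphism over $M$; $H^0(B,\mathscr S_P|_B)$ is the space of global smooth sections of $\iota^*L$ that are covariantly constant for $\iota^*\nabla$; the leaf is Bohr–Sommerfeld if this space is nonzero, and $BS(P)$ is the set of Bohr–Sommerfeld leaves. A trivialization cover $(\mathscr U,s)$ of $L$ is an open cover $\{U_\alpha\}$ of $M$ with nowhere vanishing smooth sections $s_\alpha$ of $L$ over $U_\alpha$; its local data are $\lambda_{\alpha\beta}$ and $\theta_\alpha$ with $s_\alpha=\lambda_{\alpha\beta}s_\beta$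 on $U_\alpha\cap U_\beta$ and $\theta_\alpha(X)s_\alpha=-i\nabla_X s_\alpha$. A trivialization cover $(\Phi^*\mathscr U,t)$, where $\Phi^*\mathscr U=\{\Phi^{-1}(U_\alpha)\}$, is complementary to $(\mathscr U,s)$ if its local data are $\Phi^*\lambda$ and $\Phi^*\theta$. Suppose that $\check H^1(M,\underline{\mathbb C}^\times_M)=0$, where $\underline{\mathbb C}^\times_M$ is the sheaf of locally constant $\mathbb C^\times$-valued functions. Then: 1. $\Phi(P)$ is a polarization. Trivialization covers of $L$ exist, and every trivialization cover has a complementary one. 2. An integral manifold $\iota:B\to M$ of $P$ is a leaf of $P$ if and only if $\Phi^{-1}\circ\iota$ is a leaf of $\Phi(P)$. The map $\iota\mapsto\Phi^{-1}\circ\iota$ induces a bijection $B\mapsto\Phi(B)$ from the set of leaves of $P$ to the set of leaves of $\Phi(P)$, and $B$ is Bohr–Sommerfeld if and only if $\Phi(B)$ is. 3. Let $(\mathscr U,s)$ be a trivialization cover and $(\Phi^*\mathscr U,t)$ a complementary one. For every leaf $\iota:B\to M$ of $P$ there is a linear isomorphism $\Phi_B:H^0(B,\mathscr S_P|_B)\to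 H^0(B,\mathscr S_{\Phi(P)}|_{\Phi(B)})$ which sends a section equal to $f^\alpha\,\iota^*s_\alpha$ on $\iota^{-1}(U_\alpha)$ to the section equal to $f^\alpha\,(\Phi^{-1}\circ\iota)^*t_\alpha$ there, for all $\alpha$. The direct sum of the $\Phi_B$ over $B\in BS(P)$ is a linear isomorphism of Bohr–Sommerfeld quantizations $$\bigoplus_{B\in BS(P)}H^0(B,\mathscr S_P|_B)\longrightarrow\bigoplus_{B\in BS(\Phi(P))}H^0(B,\mathscr S_{\Phi(P)}|_B).$$ -/

import Mathlib

open Bundle Set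
open scoped Manifold ContDiff Topology

universe u v w z

noncomputable section

set_option linter.unusedSectionVars false

namespace GeomQuant

/-! ## Symplectic manifolds, prequantum line bundles, polarizations

The manifold `M` is modelled on a (finite-dimensional) real vector space `E`.  Vector fields and
sections over an open set `U` are written as total functions whose values outside `U` are
irrelevant. -/

section Base

variable {E : Type v} [NormedAddCommGroup E] [NormedSpace ℝ E]
  {M : Type u} [TopologicalSpace M] [ChartedSpace E M]

/-- `X` is a smooth vector field on `U`. -/
def SmoothVectorFieldOn [IsManifold 𝓘(ℝ, E) ∞ M] (U : Set M) (X : ∀ x : M, TangentSpace 𝓘(ℝ, E) x) : Prop :=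
  ContMDiffOn 𝓘(ℝ, E) 𝓘(ℝ, E).tangent ∞
    (fun x => (⟨x, X x⟩ : TangentBundle 𝓘(ℝ, E) M)) U

variable (E M) in
/-- Fields of bilinear forms on the tangent spaces of `M`. -/
abbrev BilinField : Type (max u v) :=
  ∀ x : M, TangentSpace 𝓘(ℝ, E) x →L[ℝ] TangentSpace 𝓘(ℝ, E) x →L[ℝ] ℝ

/-- The exterior derivative of a two-form, `dΩ(X, Y, Z)` at `x`, by the invariant formula. -/
def extDerivTwoForm (Ω : BilinField E M) (X Y Z : ∀ x : M, TangentSpace 𝓘(ℝ, E) x) (x : M) : ℝ :=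
  mvfderiv 𝓘(ℝ, E) (fun y => Ω y (Y y) (Z y)) x (X x)
    - mvfderiv 𝓘(ℝ, E) (fun y => Ω y (X y) (Z y)) x (Y x)
    + mvfderiv 𝓘(ℝ, E) (fun y => Ω y (X y) (Y y)) x (Z x)
    - Ω x (VectorField.mlieBracket 𝓘(ℝ, E) X Y x) (Z x)
    + Ω x (VectorField.mlieBracket 𝓘(ℝ, E) X Z x) (Y x)
    - Ω x (VectorField.mlieBracket 𝓘(ℝ, E) Y Z x) (X x)

/-- `Ω` is a symplectic form: a smooth, closed, nondegenerate two-form. -/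
structure IsSymplectic [IsManifold 𝓘(ℝ, E) ∞ M] (Ω : BilinField E M) : Prop where
  smooth : ContMDiff 𝓘(ℝ, E) (𝓘(ℝ, E).prod 𝓘(ℝ, E →L[ℝ] E →L[ℝ] ℝ)) ∞
    (fun x => (TotalSpace.mk' (E →L[ℝ] E →L[ℝ] ℝ) x (Ω x) :
      TotalSpace (E →L[ℝ] E →L[ℝ] ℝ)
        (fun x : M => TangentSpace 𝓘(ℝ, E) x →L[ℝ] TangentSpace 𝓘(ℝ, E) x →L[ℝ] ℝ)))
  alternating : ∀ (x : M) (a : TangentSpace 𝓘(ℝ, E) x), Ω x a a = 0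
  nondegenerate : ∀ (x : M) (a : TangentSpace 𝓘(ℝ, E) x), (∀ b, Ω x a b = 0) → a = 0
  closed : ∀ (U : Set M), IsOpen U → ∀ X Y Z : ∀ x : M, TangentSpace 𝓘(ℝ, E) x,
    SmoothVectorFieldOn U X → SmoothVectorFieldOn U Y → SmoothVectorFieldOn U Z →
    ∀ x ∈ U, extDerivTwoForm Ω X Y Z x = 0

/-- The diffeomorphism `Φ` preserves `Ω`, i.e. `Φ^* Ω = Ω`. -/
def IsSymplectomorphism (Ω : BilinField E M) (Φ : M ≃ₘ^∞⟮𝓘(ℝ, E), 𝓘(ℝ, E)⟯ M) : Prop :=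
  ∀ (x : M) (a b : TangentSpace 𝓘(ℝ, E) x),
    Ω (Φ x) (mfderiv 𝓘(ℝ, E) 𝓘(ℝ, E) Φ x a) (mfderiv 𝓘(ℝ, E) 𝓘(ℝ, E) Φ x b) = Ω x a b

variable (E M) in
/-- A choice of a subspace of every tangent space (of possibly varying dimension). -/
abbrev TangentDistribution : Type (max u v) := ∀ x : M, Submodule ℝ (TangentSpace 𝓘(ℝ, E) x)

/-- `X` belongs to `𝔉_P(U)`, the smooth sections of `P` over `U`. -/
def IsSectionOn [IsManifold 𝓘(ℝ, E) ∞ M] (P : TangentDistribution E M) (U : Set M) (X : ∀ x : M, TangentSpace 𝓘(ℝ, E) x) : Prop :=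
  SmoothVectorFieldOn U X ∧ ∀ x ∈ U, X x ∈ P x

/-- `P` is a (singular, real) polarization of `(M, Ω)`. -/
structure IsPolarization [IsManifold 𝓘(ℝ, E) ∞ M] (Ω : BilinField E M) (P : TangentDistribution E M) : Prop where
  /-- `P` is a smooth singular subbundle: each of its vectors is the value of a local section. -/
  smooth : ∀ (x : M), ∀ a ∈ P x, ∃ U : Set M, IsOpen U ∧ x ∈ U ∧
    ∃ X, IsSectionOn P U X ∧ X x = a
  involutive : ∀ U : Set M, IsOpen U → ∀ X Y, IsSectionOn P U X → IsSectionOn P U Y →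
    IsSectionOn P U (VectorField.mlieBracket 𝓘(ℝ, E) X Y)
  locally_finitely_generated : ∀ x : M, ∃ U : Set M, IsOpen U ∧ x ∈ U ∧
    ∃ (k : ℕ) (X : Fin k → ∀ y : M, TangentSpace 𝓘(ℝ, E) y), (∀ i, IsSectionOn P U (X i)) ∧
      ∀ Y, IsSectionOn P U Y → ∃ f : Fin k → M → ℝ,
        (∀ i, ContMDiffOn 𝓘(ℝ, E) 𝓘(ℝ, ℝ) ∞ (f i) U) ∧ ∀ y ∈ U, Y y = ∑ i, f i y • X i y
  /-- On a dense open set each `P x` equals its own `Ω`-orthogonal complement. -/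
  lagrangian : ∃ U : Set M, IsOpen U ∧ Dense U ∧
    ∀ x ∈ U, ∀ a, a ∈ P x ↔ ∀ b ∈ P x, Ω x a b = 0

/-- The distribution `Φ(P)`, with `Φ(P)_x = (dΦ_x)⁻¹ (P_{Φ(x)}) = (Φ⁻¹)_* (P_{Φ(x)})`. -/
def transport (Φ : M ≃ₘ^∞⟮𝓘(ℝ, E), 𝓘(ℝ, E)⟯ M) (P : TangentDistribution E M) : TangentDistribution E M :=
  fun x => (P (Φ x)).comap (mfderiv 𝓘(ℝ, E) 𝓘(ℝ, E) Φ x).toLinearMap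

theorem mfderiv_symm_mfderiv [IsManifold 𝓘(ℝ, E) ∞ M] (Φ : M ≃ₘ^∞⟮𝓘(ℝ, E), 𝓘(ℝ, E)⟯ M) (y : M)
    (a : E) : (mfderiv 𝓘(ℝ, E) 𝓘(ℝ, E) Φ.symm (Φ y) (mfderiv 𝓘(ℝ, E) 𝓘(ℝ, E) Φ y a) : E) = a := by
  have h := mfderiv_comp (I := 𝓘(ℝ, E)) (I' := 𝓘(ℝ, E)) (I'' := 𝓘(ℝ, E)) y
    (Φ.symm.contMDiff.mdifferentiable (by simp) (Φ y)) (Φ.contMDiff.mdifferentiable (by simp) y)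
  have h1 : (Φ.symm ∘ Φ : M → M) = id := funext Φ.symm_apply_apply
  rw [h1, mfderiv_id] at h
  exact (congrArg (fun T : E →L[ℝ] E => T a) h).symm

theorem mem_transport_iff [IsManifold 𝓘(ℝ, E) ∞ M] (Φ : M ≃ₘ^∞⟮𝓘(ℝ, E), 𝓘(ℝ, E)⟯ M)
    (P : TangentDistribution E M) (z : M) (a : E) :
    a ∈ (transport Φ P (Φ.symm z) : Submodule ℝ E) ↔
      ∃ c : E, c ∈ (P z : Submodule ℝ E) ∧
        (mfderiv 𝓘(ℝ, E) 𝓘(ℝ, E) Φ.symm z c : E) = a := by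
  obtain ⟨y, rfl⟩ : ∃ y, Φ y = z := ⟨Φ.symm z, Φ.apply_symm_apply z⟩
  suffices h : ∀ y', y' = y → (a ∈ (transport Φ P y' : Submodule ℝ E) ↔
      ∃ c : E, c ∈ (P (Φ y) : Submodule ℝ E) ∧
        (mfderiv 𝓘(ℝ, E) 𝓘(ℝ, E) Φ.symm (Φ y) c : E) = a) from h _ (Φ.symm_apply_apply y)
  rintro _ rfl
  rename_i y
  constructor
  · intro h
    exact ⟨mfderiv 𝓘(ℝ, E) 𝓘(ℝ, E) Φ y a, h, mfderiv_symm_mfderiv Φ y a⟩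
  · rintro ⟨c, hc, rfl⟩
    have h0 : ∀ y', y' = y → (mfderiv 𝓘(ℝ, E) 𝓘(ℝ, E) Φ y'
        (mfderiv 𝓘(ℝ, E) 𝓘(ℝ, E) Φ.symm (Φ y) c) : E) = c →
        (mfderiv 𝓘(ℝ, E) 𝓘(ℝ, E) Φ y
          (mfderiv 𝓘(ℝ, E) 𝓘(ℝ, E) Φ.symm (Φ y) c) : E) = c := by
      rintro _ rfl h
      exact h
    have h := h0 _ (Φ.symm_apply_apply y) (mfderiv_symm_mfderiv Φ.symm (Φ y) c)
    change (mfderiv 𝓘(ℝ, E) 𝓘(ℝ, E) Φ y (mfderiv 𝓘(ℝ, E) 𝓘(ℝ, E) Φ.symm (Φ y) c) : E)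
      ∈ (P (Φ y) : Submodule ℝ E)
    exact h.symm ▸ hc

/-! ## Vanishing of the first Čech cohomology with coefficients in `ℂˣ` -/

/-- A Čech `1`-cocycle on the family `U` with values in the sheaf of locally constant
`ℂˣ`-valued functions. -/
structure CechCocycle {J : Type u} (U : J → TopologicalSpace.Opens M) where
  toFun : ∀ α β : J, LocallyConstant (U α ⊓ U β : TopologicalSpace.Opens M) ℂˣ
  cocycle : ∀ (α β γ : J) (x : M) (hα : x ∈ U α) (hβ : x ∈ U β) (hγ : x ∈ U γ),
    toFun α β ⟨x, hα, hβ⟩ * toFun β γ ⟨x, hβ, hγ⟩ = toFun α γ ⟨x, hα, hγ⟩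

variable (M) in
/-- `Ȟ¹(M, ℂˣ) = 0`, where `Ȟ¹` is the direct limit over open covers ordered by refinement:
every `1`-cocycle on every open cover becomes a coboundary on some refinement of the cover. -/
def CechH1Vanishes : Prop :=
  ∀ (J : Type u) (U : J → TopologicalSpace.Opens M), (∀ x, ∃ α, x ∈ U α) →
    ∀ c : CechCocycle U,
      ∃ (K : Type u) (V : K → TopologicalSpace.Opens M) (r : K → J) (hr : ∀ k, V k ≤ U (r k)),
        (∀ x, ∃ k, x ∈ V k) ∧
        ∃ g : ∀ k, LocallyConstant (V k) ℂˣ,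
          ∀ (k l : K) (x : M) (hk : x ∈ V k) (hl : x ∈ V l),
            c.toFun (r k) (r l) ⟨x, hr k hk, hr l hl⟩ = g l ⟨x, hl⟩ / g k ⟨x, hk⟩

end Base

/-! ## Line bundles -/

section LineBundle

variable {E : Type v} [NormedAddCommGroup E] [NormedSpace ℝ E]
  {M : Type u} [TopologicalSpace M] [ChartedSpace E M]
  {L : M → Type w} [TopologicalSpace (TotalSpace ℂ L)]
  [∀ x, TopologicalSpace (L x)] [∀ x, AddCommGroup (L x)] [∀ x, Module ℂ (L x)]
  [FiberBundle ℂ L]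

/-- The section `σ` is smooth on `U`. -/
def SmoothSectionOn (U : Set M) (σ : ∀ x, L x) : Prop :=
  ContMDiffOn 𝓘(ℝ, E) (𝓘(ℝ, E).prod 𝓘(ℝ, ℂ)) ∞ (fun x => TotalSpace.mk' ℂ x (σ x)) U

variable (E L) in
/-- A smooth Hermitian metric on a complex line bundle (conjugate-linear in the first slot). -/
structure HermitianMetric where
  form : ∀ x : M, L x →ₗ⋆[ℂ] L x →ₗ[ℂ] ℂ
  conj_symm : ∀ (x : M) (a b : L x), (starRingEnd ℂ) (form x a b) = form x b a
  pos : ∀ (x : M) (a : L x), a ≠ 0 → 0 < (form x a a).re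
  smooth : ∀ (U : Set M), IsOpen U → ∀ σ τ : ∀ x, L x,
    SmoothSectionOn (E := E) U σ → SmoothSectionOn (E := E) U τ →
    ContMDiffOn 𝓘(ℝ, E) 𝓘(ℝ, ℂ) ∞ (fun x => form x (σ x) (τ x)) U

/-- The quotient `a / b` of two elements of a fibre, computed in a trivialization. -/
def ratio {x : M} (a b : L x) : ℂ :=
  (trivializationAt ℂ L x ⟨x, a⟩).2 / (trivializationAt ℂ L x ⟨x, b⟩).2

/-- `a / b` is the unique scalar with `(a / b) • b = a`. -/
theorem eq_ratio_iff [VectorBundle ℂ ℂ L] {x : M} {a b : L x} (hb : b ≠ 0) (c : ℂ) :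
    c = ratio a b ↔ a = c • b := by
  have hx := mem_baseSet_trivializationAt ℂ L x
  set e := (trivializationAt ℂ L x).continuousLinearEquivAt ℂ x hx with he
  have h1 : ∀ y : L x, (trivializationAt ℂ L x ⟨x, y⟩).2 = e y := fun y => rfl
  have hb' : e b ≠ 0 := by simpa using hb
  unfold ratio
  rw [h1, h1, eq_div_iff hb', ← e.injective.eq_iff, map_smul, smul_eq_mul]
  exact eq_comm

theorem baseSet_mem_nhds (x : M) : (trivializationAt ℂ L x).baseSet ∈ 𝓝 x :=
  (trivializationAt ℂ L x).open_baseSet.mem_nhds (mem_baseSet_trivializationAt ℂ L x)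

theorem coord_isLinear [VectorBundle ℂ ℂ L] {x y : M} (hy : y ∈ (trivializationAt ℂ L x).baseSet) :
    IsLinearMap ℂ fun v : L y => (trivializationAt ℂ L x ⟨y, v⟩).2 :=
  (trivializationAt ℂ L x).linear ℂ hy

section Along

variable {F : Type*} [NormedAddCommGroup F] [NormedSpace ℝ F]
  {B : Type*} [TopologicalSpace B] [ChartedSpace F B]

theorem mvfderiv_congr {f g : B → ℂ} {b : B} (h : f =ᶠ[𝓝 b] g) :
    mvfderiv 𝓘(ℝ, F) f b = mvfderiv 𝓘(ℝ, F) g b := by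
  ext a
  simp only [mvfderiv, h.mfderiv_eq]
  rfl

theorem mvfderiv_const_mul {f : B → ℂ} {b : B} (c : ℂ)
    (hf : MDifferentiableAt 𝓘(ℝ, F) 𝓘(ℝ, ℂ) f b) (a : TangentSpace 𝓘(ℝ, F) b) :
    mvfderiv 𝓘(ℝ, F) (fun b' => c * f b') b a = c * mvfderiv 𝓘(ℝ, F) f b a := by
  have h : mvfderiv 𝓘(ℝ, F) (fun b' => c * f b') b
      = (c • (mvfderiv 𝓘(ℝ, F) f b : TangentSpace 𝓘(ℝ, F) b →L[ℝ] ℂ)) := by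
    have h2 := hf.hasMFDerivAt
    exact HasMFDerivAt.mfderiv ⟨h2.1.const_smul c, h2.2.const_smul c⟩
  rw [h]
  rfl

/-- `τ` is a smooth section of `ι^*L` over `B`. -/
def SmoothAlong (E : Type v) [NormedAddCommGroup E] [NormedSpace ℝ E] [ChartedSpace E M]
    (F : Type*) [NormedAddCommGroup F] [NormedSpace ℝ F] [ChartedSpace F B]
    (ι : B → M) (τ : ∀ b, L (ι b)) : Prop :=
  ContMDiff 𝓘(ℝ, F) (𝓘(ℝ, E).prod 𝓘(ℝ, ℂ)) ∞ (fun b => TotalSpace.mk' ℂ (ι b) (τ b))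

variable {ι : B → M}

theorem smoothAlong_iff {τ : ∀ b, L (ι b)} : SmoothAlong E F ι τ ↔
    ContMDiff 𝓘(ℝ, F) 𝓘(ℝ, E) ∞ ι ∧ ∀ b, ContMDiffAt 𝓘(ℝ, F) 𝓘(ℝ, ℂ) ∞
      (fun b' => (trivializationAt ℂ L (ι b) ⟨ι b', τ b'⟩).2) b := by
  unfold SmoothAlong ContMDiff
  simp only [contMDiffAt_totalSpace]
  exact forall_and

variable [VectorBundle ℂ ℂ L]

theorem coord_add (hι : Continuous ι) (τ τ' : ∀ b, L (ι b)) (b : B) :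
    (fun b' => (trivializationAt ℂ L (ι b) ⟨ι b', (τ + τ') b'⟩).2) =ᶠ[𝓝 b]
      fun b' => (trivializationAt ℂ L (ι b) ⟨ι b', τ b'⟩).2
        + (trivializationAt ℂ L (ι b) ⟨ι b', τ' b'⟩).2 := by
  filter_upwards [hι.continuousAt.preimage_mem_nhds (baseSet_mem_nhds (L := L) (ι b))] with b' hb'
  exact (coord_isLinear hb').map_add _ _

theorem coord_smul (hι : Continuous ι) (c : ℂ) (τ : ∀ b, L (ι b)) (b : B) :
    (fun b' => (trivializationAt ℂ L (ι b) ⟨ι b', (c • τ) b'⟩).2) =ᶠ[𝓝 b]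
      fun b' => c * (trivializationAt ℂ L (ι b) ⟨ι b', τ b'⟩).2 := by
  filter_upwards [hι.continuousAt.preimage_mem_nhds (baseSet_mem_nhds (L := L) (ι b))] with b' hb'
  exact (coord_isLinear hb').map_smul _ _

end Along

variable [∀ x, IsTopologicalAddGroup (L x)] [∀ x, ContinuousSMul ℝ (L x)]

variable (L) in
/-- The data which make a complex line bundle `L → M` a prequantum line bundle of `(M, Ω)`: a
Hermitian metric and a compatible smooth complex-linear connection whose curvature two-form is
`Ω`, in the normalization where `∇ s = i θ s` has curvature two-form `dθ`. -/
structure PrequantumStructure [IsManifold 𝓘(ℝ, E) ∞ M] [VectorBundle ℝ ℂ L]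
    (Ω : BilinField E M) where
  metric : HermitianMetric E L
  /-- `cov σ x a` is `∇_a σ` at `x`. -/
  cov : CovariantDerivative 𝓘(ℝ, E) ℂ L
  cov_smooth : cov.ContMDiffCovariantDerivative ∞
  cov_complex : ∀ (c : ℂ) (σ : ∀ x, L x) (x : M),
    MDifferentiableAt 𝓘(ℝ, E) (𝓘(ℝ, E).prod 𝓘(ℝ, ℂ)) (fun y => TotalSpace.mk' ℂ y (σ y)) x →
    ∀ a : TangentSpace 𝓘(ℝ, E) x, cov (fun y => c • σ y) x a = c • cov σ x a
  compatible : ∀ (U : Set M), IsOpen U → ∀ σ τ : ∀ x, L x,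
    SmoothSectionOn (E := E) U σ → SmoothSectionOn (E := E) U τ →
    ∀ x ∈ U, ∀ a : TangentSpace 𝓘(ℝ, E) x,
      mvfderiv 𝓘(ℝ, E) (fun y => metric.form y (σ y) (τ y)) x a =
        metric.form x (cov σ x a) (τ x) + metric.form x (σ x) (cov τ x a)
  curvature : ∀ (U : Set M), IsOpen U → ∀ X Y : ∀ x : M, TangentSpace 𝓘(ℝ, E) x,
    SmoothVectorFieldOn U X → SmoothVectorFieldOn U Y →
    ∀ σ : ∀ x, L x, SmoothSectionOn (E := E) U σ → ∀ x ∈ U,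
      cov (fun y => cov σ y (Y y)) x (X x) - cov (fun y => cov σ y (X y)) x (Y x)
        - cov σ x (VectorField.mlieBracket 𝓘(ℝ, E) X Y x)
      = (Complex.I * (Ω x (X x) (Y x) : ℂ)) • σ x

/-! ### Trivialization covers and their local data -/

variable (E L) in
/-- A trivialization cover of `L`: an open cover of `M` with a nowhere vanishing smooth section
over each of its members. -/
structure TrivializationCover (J : Type z) where
  U : J → TopologicalSpace.Opens M
  cover : ∀ x, ∃ α, x ∈ U α
  s : J → ∀ x, L x
  smooth : ∀ α, SmoothSectionOn (E := E) (U α : Set M) (s α)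
  ne_zero : ∀ α, ∀ x ∈ U α, s α x ≠ 0

namespace TrivializationCover

variable {J : Type z}

/-- The transition function `λ_{αβ}`, with `s_α = λ_{αβ} s_β` on `U_α ∩ U_β`. -/
def transition (T : TrivializationCover E L J) (α β : J) (x : M) : ℂ := ratio (T.s α x) (T.s β x)

/-- The connection one-form `θ_α`, with `θ_α(X) s_α = -i ∇_X s_α` on `U_α`. -/
def connForm (T : TrivializationCover E L J) (cov : CovariantDerivative 𝓘(ℝ, E) ℂ L)
    (α : J) (x : M) (a : TangentSpace 𝓘(ℝ, E) x) : ℂ :=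
  ratio (-Complex.I • cov (T.s α) x a) (T.s α x)

/-- `T'` is complementary to `T` with respect to `Φ`: its cover is `Φ^*𝒰`, and its local data are
`λ' = Φ^*λ` and `θ' = Φ^*θ`. -/
structure IsComplementary (cov : CovariantDerivative 𝓘(ℝ, E) ℂ L)
    (Φ : M ≃ₘ^∞⟮𝓘(ℝ, E), 𝓘(ℝ, E)⟯ M) (T T' : TrivializationCover E L J) : Prop where
  cover_eq : ∀ α, (T'.U α : Set M) = Φ ⁻¹' (T.U α : Set M)
  transition_eq : ∀ α β, ∀ x ∈ T'.U α, x ∈ T'.U β →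
    T'.transition α β x = T.transition α β (Φ x)
  connForm_eq : ∀ α, ∀ x ∈ T'.U α, ∀ a : TangentSpace 𝓘(ℝ, E) x,
    T'.connForm cov α x a = T.connForm cov α (Φ x) (mfderiv 𝓘(ℝ, E) 𝓘(ℝ, E) Φ x a)

end TrivializationCover

/-! ### Covariantly constant sections of a pullback bundle -/

section Pullback

variable {F : Type*} [NormedAddCommGroup F] [NormedSpace ℝ F]
  {B : Type*} [TopologicalSpace B] [ChartedSpace F B]

/-- The pullback covariant derivative `(ι^*∇)_a τ` at `b`, for a section `τ` of `ι^*L`.  With `e`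
the local frame of `L` near `ι b` given by a trivialization, and `τ = f · ι^*e` near `b`, it is
`df(a) · e(ι b) + f(b) · ∇_{dι(a)} e`. -/
def pullbackCov (cov : CovariantDerivative 𝓘(ℝ, E) ℂ L) (ι : B → M) (τ : ∀ b, L (ι b))
    (b : B) (a : TangentSpace 𝓘(ℝ, F) b) : L (ι b) :=
  mvfderiv 𝓘(ℝ, F) (fun b' => (trivializationAt ℂ L (ι b) ⟨ι b', τ b'⟩).2) b a •
      (trivializationAt ℂ L (ι b)).symm (ι b) 1
    + (trivializationAt ℂ L (ι b) ⟨ι b, τ b⟩).2 •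
      cov (fun y => (trivializationAt ℂ L (ι b)).symm y 1) (ι b)
        (mfderiv 𝓘(ℝ, F) 𝓘(ℝ, E) ι b a)

variable [VectorBundle ℂ ℂ L]

variable (F) in
/-- The global smooth sections `τ` of `ι^*L → B` with `(ι^*∇)_a τ = 0` for all tangent vectors
`a` of `B`. -/
def parallelSections (cov : CovariantDerivative 𝓘(ℝ, E) ℂ L) (ι : B → M)
    (hι : ContMDiff 𝓘(ℝ, F) 𝓘(ℝ, E) ∞ ι) : Submodule ℂ (∀ b, L (ι b)) where
  carrier := {τ | SmoothAlong E F ι τ ∧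
    ∀ (b : B) (a : TangentSpace 𝓘(ℝ, F) b), pullbackCov cov ι τ b a = 0}
  zero_mem' := by
    have h : ∀ b, (fun b' => (trivializationAt ℂ L (ι b) ⟨ι b', (0 : ∀ b, L (ι b)) b'⟩).2)
        =ᶠ[𝓝 b] fun _ => (0 : ℂ) := fun b => by
      simpa using coord_smul hι.continuous 0 (0 : ∀ b, L (ι b)) b
    refine ⟨smoothAlong_iff.2 ⟨hι, fun b => contMDiffAt_const.congr_of_eventuallyEq (h b)⟩,
      fun b a => ?_⟩
    rw [pullbackCov, mvfderiv_congr (h b), (h b).eq_of_nhds, mvfderiv_const]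
    simp
  add_mem' := by
    rintro τ τ' ⟨hτ, h0⟩ ⟨hτ', h0'⟩
    have h := coord_add hι.continuous τ τ'
    have hs := (smoothAlong_iff.1 hτ).2
    have hs' := (smoothAlong_iff.1 hτ').2
    refine ⟨smoothAlong_iff.2 ⟨hι, fun b => ((hs b).add (hs' b)).congr_of_eventuallyEq (h b)⟩,
      fun b a => ?_⟩
    have e := congrArg₂ (· + ·) (h0 b a) (h0' b a)
    simp only [pullbackCov, add_zero] at e
    rw [pullbackCov, mvfderiv_congr (h b), (h b).eq_of_nhds, mvfderiv_fun_add
      ((hs b).mdifferentiableAt (by simp)) ((hs' b).mdifferentiableAt (by simp)), ← e,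
      _root_.add_apply, add_smul, add_smul]
    abel
  smul_mem' := by
    rintro c τ ⟨hτ, h0⟩
    have h := coord_smul hι.continuous c τ
    have hs := (smoothAlong_iff.1 hτ).2
    refine ⟨smoothAlong_iff.2 ⟨hι, fun b =>
      (((contDiff_const.mul contDiff_id).contMDiff.contMDiffAt (x := _)).comp b (hs b)
        : ContMDiffAt 𝓘(ℝ, F) 𝓘(ℝ, ℂ) ∞ (fun b' => c * (trivializationAt ℂ L (ι b) ⟨ι b', τ b'⟩).2)
          b).congr_of_eventuallyEq (h b)⟩, fun b a => ?_⟩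
    have e := congrArg (c • ·) (h0 b a)
    simp only [pullbackCov, smul_zero] at e
    rw [pullbackCov, mvfderiv_congr (h b), (h b).eq_of_nhds, mvfderiv_const_mul c
      ((hs b).mdifferentiableAt (by simp)), ← e, mul_smul, mul_smul, smul_add]

end Pullback

/-! ## Leaves and the Bohr-Sommerfeld quantization -/

/-- A connected immersed integral submanifold `ι : B → M` of `P`: an injective immersion of a
connected (Hausdorff, second countable) manifold with `ι_*(T_b B) = P_{ι b}` for all `b`. -/
structure IntegralManifold (P : TangentDistribution E M) where
  dim : ℕ
  B : Type u
  [topB : TopologicalSpace B]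
  [chartedB : ChartedSpace (EuclideanSpace ℝ (Fin dim)) B]
  [manifoldB : IsManifold (𝓡 dim) ∞ B]
  [t2B : T2Space B]
  [secondCountableB : SecondCountableTopology B]
  [connectedB : ConnectedSpace B]
  ι : B → M
  smooth : ContMDiff (𝓡 dim) 𝓘(ℝ, E) ∞ ι
  injective : Function.Injective ι
  immersion : ∀ b, Function.Injective (mfderiv (𝓡 dim) 𝓘(ℝ, E) ι b)
  tangent : ∀ b, (mfderiv (𝓡 dim) 𝓘(ℝ, E) ι b).toLinearMap.range = P (ι b)

attribute [instance] IntegralManifold.topB IntegralManifold.chartedB IntegralManifold.manifoldB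
  IntegralManifold.t2B IntegralManifold.secondCountableB IntegralManifold.connectedB

namespace IntegralManifold

variable {P : TangentDistribution E M}

/-- `ι : B → M` is a leaf, i.e. maximal: every connected integral manifold `ι' : B' → M` which
meets it factors through it by a smooth open embedding `F : B' → B`. -/
def IsLeaf (N : IntegralManifold P) : Prop :=
  ∀ N' : IntegralManifold P, (range N'.ι ∩ range N.ι).Nonempty →
    ∃ F : N'.B → N.B, Topology.IsOpenEmbedding F ∧ ContMDiff (𝓡 N'.dim) (𝓡 N.dim) ∞ F ∧
      N.ι ∘ F = N'.ι

/-- Leaves with the same image are diffeomorphic over `M`. -/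
theorem IsLeaf.exists_diffeomorph {N N' : IntegralManifold P} (h : N.IsLeaf) (h' : N'.IsLeaf)
    (hr : range N'.ι = range N.ι) :
    ∃ F : N'.B ≃ₘ^∞⟮𝓡 N'.dim, 𝓡 N.dim⟯ N.B, N.ι ∘ F = N'.ι := by
  obtain ⟨b⟩ : Nonempty N.B := inferInstance
  obtain ⟨F, -, hF, e⟩ := h N' ⟨N.ι b, hr ▸ mem_range_self b, mem_range_self b⟩
  obtain ⟨G, -, hG, e'⟩ := h' N ⟨N.ι b, mem_range_self b, hr ▸ mem_range_self b⟩
  exact ⟨⟨⟨F, G, fun x => N'.injective ((congrFun e' _).trans (congrFun e x)),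
    fun x => N.injective ((congrFun e _).trans (congrFun e' x))⟩, hF, hG⟩, e⟩

/-- The integral manifold `Φ⁻¹ ∘ ι : B → M` of `Φ(P)`. -/
def transport [IsManifold 𝓘(ℝ, E) ∞ M] (N : IntegralManifold P)
    (Φ : M ≃ₘ^∞⟮𝓘(ℝ, E), 𝓘(ℝ, E)⟯ M) : IntegralManifold (GeomQuant.transport Φ P) where
  dim := N.dim
  B := N.B
  ι := Φ.symm ∘ N.ι
  smooth := Φ.symm.contMDiff.comp N.smooth
  injective := Φ.symm.injective.comp N.injective
  immersion b := by
    have h := mfderiv_comp (I := 𝓡 N.dim) (I' := 𝓘(ℝ, E)) (I'' := 𝓘(ℝ, E)) b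
      (Φ.symm.contMDiff.mdifferentiable (by simp) (N.ι b)) (N.smooth.mdifferentiable (by simp) b)
    rw [h]
    exact (Function.LeftInverse.injective (g := mfderiv 𝓘(ℝ, E) 𝓘(ℝ, E) Φ.symm.symm _)
      (mfderiv_symm_mfderiv Φ.symm (N.ι b))).comp (N.immersion b)
  tangent b := by
    have h := mfderiv_comp (I := 𝓡 N.dim) (I' := 𝓘(ℝ, E)) (I'' := 𝓘(ℝ, E)) b
      (Φ.symm.contMDiff.mdifferentiable (by simp) (N.ι b)) (N.smooth.mdifferentiable (by simp) b)
    rw [h]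
    ext a
    refine Iff.trans ?_ (mem_transport_iff Φ P (N.ι b) a).symm
    rw [← N.tangent b]
    constructor
    · rintro ⟨c, rfl⟩
      exact ⟨_, ⟨c, rfl⟩, rfl⟩
    · rintro ⟨_, ⟨c, rfl⟩, rfl⟩
      exact ⟨c, rfl⟩

variable [VectorBundle ℂ ℂ L]

/-- `H⁰(B, 𝒮_P|_B)`, the space of covariantly constant sections of `ι^*L → B`. -/
def H0 (N : IntegralManifold P) (cov : CovariantDerivative 𝓘(ℝ, E) ℂ L) :
    Submodule ℂ (∀ b : N.B, L (N.ι b)) :=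
  parallelSections (EuclideanSpace ℝ (Fin N.dim)) cov N.ι N.smooth

end IntegralManifold

/-- The set of leaves of `P`.  By maximality, two leaves `ι : B → M` with the same image are
related by a unique diffeomorphism over `M`, so a leaf is recorded by its image in `M`. -/
def Leaf (P : TangentDistribution E M) : Type u :=
  {S : Set M // ∃ N : IntegralManifold P, N.IsLeaf ∧ range N.ι = S}

namespace Leaf

variable {P : TangentDistribution E M}

/-- The leaf `ι : B → M` with image `ℓ`. -/
def rep (ℓ : Leaf P) : IntegralManifold P := ℓ.2.choose

theorem rep_isLeaf (ℓ : Leaf P) : ℓ.rep.IsLeaf := ℓ.2.choose_spec.1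

theorem range_rep (ℓ : Leaf P) : range ℓ.rep.ι = ℓ.1 := ℓ.2.choose_spec.2

variable [VectorBundle ℂ ℂ L]

/-- The leaf is Bohr-Sommerfeld: `H⁰(B, 𝒮_P|_B) ≠ 0`. -/
def IsBohrSommerfeld (cov : CovariantDerivative 𝓘(ℝ, E) ℂ L) (ℓ : Leaf P) : Prop :=
  ℓ.rep.H0 cov ≠ ⊥

end Leaf

section Quantization

variable [VectorBundle ℂ ℂ L]

/-- `BS(P)`, the set of Bohr-Sommerfeld leaves of `P`. -/
abbrev BSLeaf (cov : CovariantDerivative 𝓘(ℝ, E) ℂ L) (P : TangentDistribution E M) : Type u :=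
  {ℓ : Leaf P // ℓ.IsBohrSommerfeld cov}

/-- The Bohr-Sommerfeld quantization `⨁_{B ∈ BS(P)} H⁰(B, 𝒮_P|_B)`. -/
abbrev BSQuantization (cov : CovariantDerivative 𝓘(ℝ, E) ℂ L) (P : TangentDistribution E M) :
    Type (max u w) :=
  DirectSum (BSLeaf cov P) fun ℓ => ℓ.1.rep.H0 cov

open Classical in
/-- The inclusion of the summand of a Bohr-Sommerfeld leaf. -/
def BSQuantization.summand (cov : CovariantDerivative 𝓘(ℝ, E) ℂ L) (P : TangentDistribution E M)
    (ℓ : BSLeaf cov P) : ℓ.1.rep.H0 cov →ₗ[ℂ] BSQuantization cov P :=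
  DirectSum.lof ℂ (BSLeaf cov P) (fun ℓ => ℓ.1.rep.H0 cov) ℓ

end Quantization

end LineBundle

end GeomQuant

end

open GeomQuant

/-! A complementary cover amounts to an isomorphism of `Φ^*L` with `L` that respects the
connections, and such an isomorphism is obstructed only by a class in `Ȟ¹(M, ℂˣ)`.

Locally there is no obstruction. If `θ` is the connection form of a frame `s` near `Φ x`, then
`d(Φ^*θ) = Φ^*Ω = Ω`, which is also the exterior derivative of the connection form `θ₀` of any frame
near `x`. So `Φ^*θ - θ₀` is closed, hence equal to `df` on a convex chart, and rescaling by
`exp(if)` gives a frame with connection form `Φ^*θ` (`fderiv_coordForm_sub`,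
`exists_frame_pullback`).

Two such frames have a transition function with the same logarithmic derivative as `Φ^*λ`, so the
quotient of the two is locally constant (`eventually_ratio_div_ratio_eq`). These quotients form a
Čech cocycle. By hypothesis it is a coboundary on a refinement, and multiplying the frames by the
locally constant cochain makes their transition functions exactly `Φ^*λ`
(`exists_compatible_frames`). They then glue to a frame on each `Φ⁻¹(U_α)`
(`exists_isComplementary`).

Given complementary covers, `s_α(Φ y) ↦ t_α(y)` defines a map of fibres independent of `α`, because
the transition functions agree. It preserves parallel sections, because `f s_α` is parallel along
`ι` exactly when `df + i f ι^*θ_α = 0` and `(Φ⁻¹ ∘ ι)^*Φ^*θ_α = ι^*θ_α` (`fiberTransfer_mem`). The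
statements about polarizations and leaves are naturality under the diffeomorphism `Φ`; only the
Lagrangian condition needs `Φ^*Ω = Ω`. -/

noncomputable section

set_option linter.unusedSectionVars false

namespace GeomQuant

/-! ### Frames, quotients of sections, and smoothness of sections along a map -/

section Frames

variable {E : Type v} [NormedAddCommGroup E] [NormedSpace ℝ E]
  {M : Type u} [TopologicalSpace M] [ChartedSpace E M]
  {L : M → Type w} [TopologicalSpace (TotalSpace ℂ L)]
  [∀ x, TopologicalSpace (L x)] [∀ x, AddCommGroup (L x)] [∀ x, Module ℂ (L x)]
  [FiberBundle ℂ L] [VectorBundle ℂ ℂ L]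
  {F : Type*} [NormedAddCommGroup F] [NormedSpace ℝ F]
  {B : Type*} [TopologicalSpace B] [ChartedSpace F B]

theorem ratio_smul_self {x : M} (a : L x) {b : L x} (hb : b ≠ 0) : ratio a b • b = a :=
  ((eq_ratio_iff hb _).1 rfl).symm

theorem ratio_smul {x : M} (c : ℂ) {b : L x} (hb : b ≠ 0) : ratio (c • b) b = c :=
  ((eq_ratio_iff hb _).2 rfl).symm

theorem ratio_ne_zero {x : M} {a b : L x} (ha : a ≠ 0) (hb : b ≠ 0) : ratio a b ≠ 0 := by
  intro h
  apply ha
  rw [← ratio_smul_self a hb, h, zero_smul]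

theorem ratio_mul_ratio {x : M} (a : L x) {b c : L x} (hb : b ≠ 0) (hc : c ≠ 0) :
    ratio a b * ratio b c = ratio a c := by
  rw [eq_ratio_iff hc, mul_smul, ratio_smul_self b hc, ratio_smul_self a hb]

theorem coord_smul_apply {x y : M} (hy : y ∈ (trivializationAt ℂ L x).baseSet) (c : ℂ) (a : L y) :
    (trivializationAt ℂ L x ⟨y, c • a⟩).2 = c * (trivializationAt ℂ L x ⟨y, a⟩).2 :=
  (coord_isLinear hy).map_smul c a

theorem coord_ne_zero {x y : M} (hy : y ∈ (trivializationAt ℂ L x).baseSet) {a : L y}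
    (ha : a ≠ 0) : (trivializationAt ℂ L x ⟨y, a⟩).2 ≠ 0 := by
  have : (trivializationAt ℂ L x ⟨y, a⟩).2
      = (trivializationAt ℂ L x).continuousLinearEquivAt ℂ y hy a := rfl
  rw [this]
  exact (map_ne_zero_iff _ (ContinuousLinearEquiv.injective _)).2 ha

/-- A quotient does not depend on the trivialization used to compute it. `ratio` uses a different
trivialization at each point; smoothness in `y` needs a fixed one. -/
theorem ratio_eq_coord_div {x y : M} (hy : y ∈ (trivializationAt ℂ L x).baseSet) (a : L y)
    {b : L y} (hb : b ≠ 0) :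
    ratio a b = (trivializationAt ℂ L x ⟨y, a⟩).2 / (trivializationAt ℂ L x ⟨y, b⟩).2 := by
  rw [eq_div_iff (coord_ne_zero hy hb), ← coord_smul_apply hy, ratio_smul_self a hb]

theorem coord_symm {x y : M} (hy : y ∈ (trivializationAt ℂ L x).baseSet) (c : ℂ) :
    (trivializationAt ℂ L x ⟨y, (trivializationAt ℂ L x).symm y c⟩).2 = c := by
  rw [(trivializationAt ℂ L x).apply_mk_symm hy]

theorem symm_one_ne_zero {x y : M} (hy : y ∈ (trivializationAt ℂ L x).baseSet) :
    (trivializationAt ℂ L x).symm y (1 : ℂ) ≠ 0 := by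
  intro h
  have h1 := coord_symm (L := L) hy 1
  rw [h] at h1
  exact zero_ne_one ((coord_isLinear (L := L) hy).map_zero.symm.trans h1)

theorem coord_smul_symm_one {x y : M} (hy : y ∈ (trivializationAt ℂ L x).baseSet) (a : L y) :
    (trivializationAt ℂ L x ⟨y, a⟩).2 • (trivializationAt ℂ L x).symm y (1 : ℂ) = a := by
  have h := (eq_ratio_iff (symm_one_ne_zero hy) _).1
    (ratio_eq_coord_div hy a (symm_one_ne_zero hy)).symm
  rw [coord_symm hy, div_one] at h
  exact h.symm

/-- `τ` is a section of `ι^*L` which is smooth at `b`. -/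
def SmoothAlongAt (E : Type v) [NormedAddCommGroup E] [NormedSpace ℝ E] [ChartedSpace E M]
    (F : Type*) [NormedAddCommGroup F] [NormedSpace ℝ F] [ChartedSpace F B]
    (ι : B → M) (τ : ∀ b, L (ι b)) (b : B) : Prop :=
  ContMDiffAt 𝓘(ℝ, F) (𝓘(ℝ, E).prod 𝓘(ℝ, ℂ)) ∞ (fun b => TotalSpace.mk' ℂ (ι b) (τ b)) b

variable {ι : B → M} {b : B}

theorem smoothAlongAt_iff {τ : ∀ b, L (ι b)} : SmoothAlongAt E F ι τ b ↔
    ContMDiffAt 𝓘(ℝ, F) 𝓘(ℝ, E) ∞ ι b ∧ ContMDiffAt 𝓘(ℝ, F) 𝓘(ℝ, ℂ) ∞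
      (fun b' => (trivializationAt ℂ L (ι b) ⟨ι b', τ b'⟩).2) b :=
  contMDiffAt_totalSpace

theorem SmoothAlongAt.eventually_baseSet {τ : ∀ b, L (ι b)} (h : SmoothAlongAt E F ι τ b) :
    ∀ᶠ b' in 𝓝 b, ι b' ∈ (trivializationAt ℂ L (ι b)).baseSet :=
  (smoothAlongAt_iff.1 h).1.continuousAt.preimage_mem_nhds (baseSet_mem_nhds (L := L) (ι b))

theorem SmoothAlongAt.congr {τ τ' : ∀ b, L (ι b)} (h : SmoothAlongAt E F ι τ b)
    (he : ∀ᶠ b' in 𝓝 b, τ' b' = τ b') : SmoothAlongAt E F ι τ' b := by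
  refine ContMDiffAt.congr_of_eventuallyEq (f := fun b => TotalSpace.mk' ℂ (ι b) (τ b)) h ?_
  filter_upwards [he] with b' hb'
  rw [hb']

theorem contMDiffAt_mul_complex {f g : B → ℂ} (hf : ContMDiffAt 𝓘(ℝ, F) 𝓘(ℝ, ℂ) ∞ f b)
    (hg : ContMDiffAt 𝓘(ℝ, F) 𝓘(ℝ, ℂ) ∞ g b) :
    ContMDiffAt 𝓘(ℝ, F) 𝓘(ℝ, ℂ) ∞ (fun x => f x * g x) b :=
  ContMDiffAt.comp (I' := 𝓘(ℝ, ℂ × ℂ)) (g := fun p : ℂ × ℂ => p.1 * p.2) b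
    (contDiff_mul.contMDiff.contMDiffAt) (hf.prodMk_space hg)

theorem contMDiffAt_div_complex {f g : B → ℂ} (hf : ContMDiffAt 𝓘(ℝ, F) 𝓘(ℝ, ℂ) ∞ f b)
    (hg : ContMDiffAt 𝓘(ℝ, F) 𝓘(ℝ, ℂ) ∞ g b) (h0 : g b ≠ 0) :
    ContMDiffAt 𝓘(ℝ, F) 𝓘(ℝ, ℂ) ∞ (fun x => f x / g x) b := by
  simp only [div_eq_mul_inv]
  exact contMDiffAt_mul_complex hf ((contDiffAt_inv ℝ h0).contMDiffAt.comp b hg)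

theorem SmoothAlongAt.smul {τ : ∀ b, L (ι b)} (h : SmoothAlongAt E F ι τ b) {f : B → ℂ}
    (hf : ContMDiffAt 𝓘(ℝ, F) 𝓘(ℝ, ℂ) ∞ f b) :
    SmoothAlongAt E F ι (fun b' => f b' • τ b') b := by
  refine smoothAlongAt_iff.2 ⟨(smoothAlongAt_iff.1 h).1,
    (contMDiffAt_mul_complex hf (smoothAlongAt_iff.1 h).2).congr_of_eventuallyEq ?_⟩
  filter_upwards [h.eventually_baseSet] with b' hb'
  exact coord_smul_apply hb' _ _

theorem SmoothAlongAt.eventually_ne_zero {τ : ∀ b, L (ι b)} (h : SmoothAlongAt E F ι τ b)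
    (h0 : τ b ≠ 0) : ∀ᶠ b' in 𝓝 b, τ b' ≠ 0 := by
  filter_upwards [h.eventually_baseSet, (smoothAlongAt_iff.1 h).2.continuousAt.eventually_ne
    (coord_ne_zero (mem_baseSet_trivializationAt ℂ L (ι b)) h0)] with b' hb' h1 h2
  apply h1
  rw [h2]
  exact (coord_isLinear hb').map_zero

theorem SmoothAlongAt.ratio {τ τ' : ∀ b, L (ι b)} (h : SmoothAlongAt E F ι τ b)
    (h' : SmoothAlongAt E F ι τ' b) (h0 : τ' b ≠ 0) :
    ContMDiffAt 𝓘(ℝ, F) 𝓘(ℝ, ℂ) ∞ (fun b' => ratio (τ b') (τ' b')) b := by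
  refine (contMDiffAt_div_complex (smoothAlongAt_iff.1 h).2 (smoothAlongAt_iff.1 h').2
    (coord_ne_zero (mem_baseSet_trivializationAt ℂ L (ι b)) h0)).congr_of_eventuallyEq ?_
  filter_upwards [h.eventually_baseSet, h'.eventually_ne_zero h0] with b' hb' hb0
  exact ratio_eq_coord_div hb' _ hb0

variable (E) in
/-- The section `σ` of `L` is smooth at `x`. -/
def SmoothSectionAt (σ : ∀ x, L x) (x : M) : Prop := SmoothAlongAt E E (fun x : M => x) σ x

theorem SmoothSectionAt.comp {σ : ∀ x, L x} (h : SmoothSectionAt E σ (ι b))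
    (hι : ContMDiffAt 𝓘(ℝ, F) 𝓘(ℝ, E) ∞ ι b) : SmoothAlongAt E F ι (fun b => σ (ι b)) b :=
  ContMDiffAt.comp (g := fun x => TotalSpace.mk' ℂ x (σ x)) b h hι

theorem SmoothSectionOn.smoothSectionAt {U : Set M} {σ : ∀ x, L x}
    (h : SmoothSectionOn (E := E) U σ) (hU : IsOpen U) {x : M} (hx : x ∈ U) :
    SmoothSectionAt E σ x := ContMDiffOn.contMDiffAt h (hU.mem_nhds hx)

theorem smoothSectionOn_of_forall {U : Set M} {σ : ∀ x, L x}
    (h : ∀ x ∈ U, SmoothSectionAt E σ x) : SmoothSectionOn (E := E) U σ :=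
  fun x hx => ContMDiffAt.contMDiffWithinAt (h x hx)

theorem smoothSectionAt_symm_one [VectorBundle ℝ ℂ L] [ContMDiffVectorBundle ∞ ℂ L 𝓘(ℝ, E)]
    {x y : M} (hy : y ∈ (trivializationAt ℂ L x).baseSet) :
    SmoothSectionAt E (fun y => (trivializationAt ℂ L x).symm y (1 : ℂ)) y := by
  refine ((trivializationAt ℂ L x).contMDiffAt_section_iff hy).2
    (contMDiffAt_const (c := (1 : ℂ)) |>.congr_of_eventuallyEq ?_)
  filter_upwards [(trivializationAt ℂ L x).open_baseSet.mem_nhds hy] with y' hy'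
  exact coord_symm hy' 1

theorem SmoothSectionAt.mdifferentiableAt {σ : ∀ x, L x} {x : M} (h : SmoothSectionAt E σ x) :
    MDifferentiableAt 𝓘(ℝ, E) (𝓘(ℝ, E).prod 𝓘(ℝ, ℂ)) (fun y => TotalSpace.mk' ℂ y (σ y)) x :=
  ContMDiffAt.mdifferentiableAt h (by simp)

theorem mvfderiv_mul_complex {f g : B → ℂ}
    (hf : MDifferentiableAt 𝓘(ℝ, F) 𝓘(ℝ, ℂ) f b) (hg : MDifferentiableAt 𝓘(ℝ, F) 𝓘(ℝ, ℂ) g b)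
    (a : TangentSpace 𝓘(ℝ, F) b) :
    mvfderiv 𝓘(ℝ, F) (fun b' => f b' * g b') b a
      = f b * mvfderiv 𝓘(ℝ, F) g b a + mvfderiv 𝓘(ℝ, F) f b a * g b := by
  obtain ⟨p, hp, ep⟩ : ∃ p : F →L[ℝ] ℂ, HasMFDerivAt 𝓘(ℝ, F) 𝓘(ℝ, ℂ) f b p ∧
      mvfderiv 𝓘(ℝ, F) f b a = p a := ⟨_, hf.hasMFDerivAt, rfl⟩
  obtain ⟨q, hq, eq⟩ : ∃ q : F →L[ℝ] ℂ, HasMFDerivAt 𝓘(ℝ, F) 𝓘(ℝ, ℂ) g b q ∧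
      mvfderiv 𝓘(ℝ, F) g b a = q a := ⟨_, hg.hasMFDerivAt, rfl⟩
  have h : HasMFDerivAt 𝓘(ℝ, F) 𝓘(ℝ, ℂ) (fun b' => f b' * g b') b (f b • q + g b • p) :=
    HasMFDerivAt.mul (p := f) (q := g) (p' := p) (q' := q) hp hq
  have e : mvfderiv 𝓘(ℝ, F) (fun b' => f b' * g b') b a
      = (mfderiv 𝓘(ℝ, F) 𝓘(ℝ, ℂ) (fun b' => f b' * g b') b : F →L[ℝ] ℂ) a := rfl
  rw [e, h.mfderiv, ep, eq, mul_comm (p a)]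
  rfl

theorem mvfderiv_comp_apply' {ι : B → M} {b : B} {h : M → ℂ}
    (hh : MDifferentiableAt 𝓘(ℝ, E) 𝓘(ℝ, ℂ) h (ι b)) (hι : MDifferentiableAt 𝓘(ℝ, F) 𝓘(ℝ, E) ι b)
    (a : TangentSpace 𝓘(ℝ, F) b) :
    mvfderiv 𝓘(ℝ, F) (fun b' => h (ι b')) b a
      = mvfderiv 𝓘(ℝ, E) h (ι b) (mfderiv 𝓘(ℝ, F) 𝓘(ℝ, E) ι b a) := by
  have h1 := hh.hasMFDerivAt.comp b hι.hasMFDerivAt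
  have e : mvfderiv 𝓘(ℝ, F) (fun b' => h (ι b')) b a
      = (mfderiv 𝓘(ℝ, F) 𝓘(ℝ, ℂ) (h ∘ ι) b : F →L[ℝ] ℂ) a := rfl
  rw [e, h1.mfderiv]
  rfl

theorem mvfderiv_clm_comp {V W : Type*} [NormedAddCommGroup V] [NormedSpace ℝ V]
    [NormedAddCommGroup W] [NormedSpace ℝ W] (T : V →L[ℝ] W) {f : B → V}
    (hf : MDifferentiableAt 𝓘(ℝ, F) 𝓘(ℝ, V) f b) (a : TangentSpace 𝓘(ℝ, F) b) :
    mvfderiv 𝓘(ℝ, F) (fun b' => T (f b')) b a = T (mvfderiv 𝓘(ℝ, F) f b a) := by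
  have h := (T.hasFDerivAt (x := f b)).hasMFDerivAt.comp b hf.hasMFDerivAt
  have e : mvfderiv 𝓘(ℝ, F) (fun b' => T (f b')) b a
      = (mfderiv 𝓘(ℝ, F) 𝓘(ℝ, W) (T ∘ f) b : F →L[ℝ] W) a := rfl
  rw [e, h.mfderiv]
  rfl

end Frames

/-! ### Complex Leibniz rule and the pullback connection -/

section Connection

variable {E : Type v} [NormedAddCommGroup E] [NormedSpace ℝ E]
  {M : Type u} [TopologicalSpace M] [ChartedSpace E M]
  {L : M → Type w} [TopologicalSpace (TotalSpace ℂ L)]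
  [∀ x, TopologicalSpace (L x)] [∀ x, AddCommGroup (L x)] [∀ x, Module ℂ (L x)]
  [FiberBundle ℂ L] [VectorBundle ℂ ℂ L]
  [∀ x, IsTopologicalAddGroup (L x)] [∀ x, ContinuousSMul ℝ (L x)]
  {F : Type*} [NormedAddCommGroup F] [NormedSpace ℝ F]
  {B : Type*} [TopologicalSpace B] [ChartedSpace F B]

/-- The connection is complex linear. -/
def IsComplexLinear (cov : CovariantDerivative 𝓘(ℝ, E) ℂ L) : Prop :=
  ∀ (c : ℂ) (σ : ∀ x, L x) (x : M),
    MDifferentiableAt 𝓘(ℝ, E) (𝓘(ℝ, E).prod 𝓘(ℝ, ℂ)) (fun y => TotalSpace.mk' ℂ y (σ y)) x →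
    ∀ a : TangentSpace 𝓘(ℝ, E) x, cov (fun y => c • σ y) x a = c • cov σ x a

variable {cov : CovariantDerivative 𝓘(ℝ, E) ℂ L}

theorem cov_congr {σ σ' : ∀ x, L x} {x : M} (h : SmoothSectionAt E σ x)
    (he : ∀ᶠ y in 𝓝 x, σ' y = σ y) : cov σ' x = cov σ x :=
  cov.isCovariantDerivativeOnUniv.congr_of_eventuallyEq (SmoothSectionAt.mdifferentiableAt (SmoothAlongAt.congr h he))
    h.mdifferentiableAt Filter.univ_mem he

/-- The Leibniz rule of a covariant derivative concerns real functions. Splitting `g σ = (Re g) σ +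
(Im g) (i σ)` and using complex linearity on `i σ` extends it to complex ones. -/
theorem IsComplexLinear.leibniz (hc : IsComplexLinear cov) {σ : ∀ x, L x} {x : M}
    (h : SmoothSectionAt E σ x) {g : M → ℂ} (hg : ContMDiffAt 𝓘(ℝ, E) 𝓘(ℝ, ℂ) ∞ g x)
    (a : TangentSpace 𝓘(ℝ, E) x) :
    cov (fun y => g y • σ y) x a = g x • cov σ x a + mvfderiv 𝓘(ℝ, E) g x a • σ x := by
  have hre : ContMDiffAt 𝓘(ℝ, E) 𝓘(ℝ, ℝ) ∞ (fun y => (g y).re) x :=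
    Complex.reCLM.contDiff.contMDiff.contMDiffAt.comp x hg
  have him : ContMDiffAt 𝓘(ℝ, E) 𝓘(ℝ, ℝ) ∞ (fun y => (g y).im) x :=
    Complex.imCLM.contDiff.contMDiff.contMDiffAt.comp x hg
  have hrec : ContMDiffAt 𝓘(ℝ, E) 𝓘(ℝ, ℂ) ∞ (fun y => ((g y).re : ℂ)) x :=
    Complex.ofRealCLM.contDiff.contMDiff.contMDiffAt.comp x hre
  have himc : ContMDiffAt 𝓘(ℝ, E) 𝓘(ℝ, ℂ) ∞ (fun y => ((g y).im : ℂ)) x :=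
    Complex.ofRealCLM.contDiff.contMDiff.contMDiffAt.comp x him
  have hIσ : SmoothSectionAt E (fun y => Complex.I • σ y) x :=
    SmoothAlongAt.smul h contMDiffAt_const
  have h1 : SmoothSectionAt E ((fun y => (g y).re) • σ) x := SmoothAlongAt.smul h hrec
  have h2 : SmoothSectionAt E ((fun y => (g y).im) • fun y => Complex.I • σ y) x :=
    SmoothAlongAt.smul hIσ himc
  have e : (fun y => g y • σ y)
      = (fun y => (g y).re) • σ + (fun y => (g y).im) • fun y => Complex.I • σ y := by
    funext y
    change g y • σ y = ((g y).re : ℂ) • σ y + ((g y).im : ℂ) • Complex.I • σ y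
    rw [smul_smul, ← add_smul, Complex.re_add_im]
  have hd : MDifferentiableAt 𝓘(ℝ, E) 𝓘(ℝ, ℂ) g x := hg.mdifferentiableAt (by simp)
  have dre := mvfderiv_clm_comp Complex.reCLM hd a
  have dim := mvfderiv_clm_comp Complex.imCLM hd a
  simp only [Complex.reCLM_apply, Complex.imCLM_apply] at dre dim
  have e1 := cov.isCovariantDerivativeOnUniv.add h1.mdifferentiableAt h2.mdifferentiableAt
  have e2 := cov.isCovariantDerivativeOnUniv.leibniz h.mdifferentiableAt
    (hre.mdifferentiableAt (by simp))
  have e3 := cov.isCovariantDerivativeOnUniv.leibniz hIσ.mdifferentiableAt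
    (him.mdifferentiableAt (by simp))
  have e4 := hc Complex.I σ x h.mdifferentiableAt a
  rw [e, e1, e2, e3]
  change ((g x).re : ℂ) • cov σ x a + ((mvfderiv 𝓘(ℝ, E) (fun y => (g y).re) x a : ℝ) : ℂ) • σ x
    + (((g x).im : ℂ) • cov (fun y => Complex.I • σ y) x a
      + ((mvfderiv 𝓘(ℝ, E) (fun y => (g y).im) x a : ℝ) : ℂ) • Complex.I • σ x) = _
  rw [e4, dre, dim]
  conv_rhs => rw [← Complex.re_add_im (g x), ← Complex.re_add_im (mvfderiv 𝓘(ℝ, E) g x a)]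
  module

variable [VectorBundle ℝ ℂ L] [ContMDiffVectorBundle ∞ ℂ L 𝓘(ℝ, E)]

/-- The pullback covariant derivative of `f · ι^*s`, for any local section `s`. -/
theorem pullbackCov_smul (hc : IsComplexLinear cov) {ι : B → M} {b : B}
    (hι : ContMDiffAt 𝓘(ℝ, F) 𝓘(ℝ, E) ∞ ι b) {s : ∀ x, L x} (hs : SmoothSectionAt E s (ι b))
    {f : B → ℂ} (hf : ContMDiffAt 𝓘(ℝ, F) 𝓘(ℝ, ℂ) ∞ f b) {τ : ∀ b, L (ι b)}
    (hτ : ∀ᶠ b' in 𝓝 b, τ b' = f b' • s (ι b')) (a : TangentSpace 𝓘(ℝ, F) b) :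
    pullbackCov cov ι τ b a = mvfderiv 𝓘(ℝ, F) f b a • s (ι b)
      + f b • cov s (ι b) (mfderiv 𝓘(ℝ, F) 𝓘(ℝ, E) ι b a) := by
  set e := trivializationAt ℂ L (ι b) with he
  have hx : ι b ∈ e.baseSet := mem_baseSet_trivializationAt ℂ L (ι b)
  set h : M → ℂ := fun y => (e ⟨y, s y⟩).2 with hh
  have hsm : ContMDiffAt 𝓘(ℝ, E) 𝓘(ℝ, ℂ) ∞ h (ι b) := (smoothAlongAt_iff.1 hs).2
  have e0 : SmoothSectionAt E (fun y => e.symm y (1 : ℂ)) (ι b) := smoothSectionAt_symm_one hx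
  -- With `s = h e` for the frame `e` in the definition of `pullbackCov`, the section `τ` has
  -- coordinate `f · (h ∘ ι)`. The product and chain rules on one side and Leibniz for `h e` on the
  -- other give the same three terms.
  have hse : ∀ᶠ y in 𝓝 (ι b), s y = h y • e.symm y (1 : ℂ) := by
    filter_upwards [e.open_baseSet.mem_nhds hx] with y hy
    exact (coord_smul_symm_one hy _).symm
  have hcoord : (fun b' => (e ⟨ι b', τ b'⟩).2) =ᶠ[𝓝 b] fun b' => f b' * h (ι b') := by
    filter_upwards [hτ, hι.continuousAt.preimage_mem_nhds (e.open_baseSet.mem_nhds hx)]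
      with b' hb' hb1
    rw [hb']
    exact coord_smul_apply hb1 _ _
  have hs1 : SmoothSectionAt E (fun y => h y • e.symm y (1 : ℂ)) (ι b) := SmoothAlongAt.smul e0 hsm
  have hhd := hsm.mdifferentiableAt (n := ∞) (by simp)
  have hιd := hι.mdifferentiableAt (n := ∞) (by simp)
  have hhι : MDifferentiableAt 𝓘(ℝ, F) 𝓘(ℝ, ℂ) (fun b' => h (ι b')) b :=
    MDifferentiableAt.comp (g := h) (f := ι) b hhd hιd
  rw [pullbackCov, mvfderiv_congr hcoord, hcoord.eq_of_nhds, mvfderiv_mul_complex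
    (g := fun b' => h (ι b')) (hf.mdifferentiableAt (by simp)) hhι, cov_congr hs1 hse, hc.leibniz e0 hsm,
    mvfderiv_comp_apply' hhd hιd]
  conv_rhs => rw [hse.self_of_nhds]
  module

end Connection

/-! ### Transfer of parallel sections between complementary covers -/

section Transfer

variable {E : Type v} [NormedAddCommGroup E] [NormedSpace ℝ E]
  {M : Type u} [TopologicalSpace M] [ChartedSpace E M]
  {L : M → Type w} [TopologicalSpace (TotalSpace ℂ L)]
  [∀ x, TopologicalSpace (L x)] [∀ x, AddCommGroup (L x)] [∀ x, Module ℂ (L x)]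
  [FiberBundle ℂ L] [VectorBundle ℂ ℂ L]
  [∀ x, IsTopologicalAddGroup (L x)] [∀ x, ContinuousSMul ℝ (L x)]
  {F : Type*} [NormedAddCommGroup F] [NormedSpace ℝ F]
  {B : Type*} [TopologicalSpace B] [ChartedSpace F B]
  {F' : Type*} [NormedAddCommGroup F'] [NormedSpace ℝ F']
  {B' : Type*} [TopologicalSpace B'] [ChartedSpace F' B']
  {J : Type z} {cov : CovariantDerivative 𝓘(ℝ, E) ℂ L}
  {Φ : M ≃ₘ^∞⟮𝓘(ℝ, E), 𝓘(ℝ, E)⟯ M}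

theorem Diffeomorph.mfderiv_mfderiv_symm [IsManifold 𝓘(ℝ, E) ∞ M]
    (Φ : M ≃ₘ^∞⟮𝓘(ℝ, E), 𝓘(ℝ, E)⟯ M) (x : M) (a : E) :
    (mfderiv 𝓘(ℝ, E) 𝓘(ℝ, E) Φ (Φ.symm x) (mfderiv 𝓘(ℝ, E) 𝓘(ℝ, E) Φ.symm x a) : E) = a :=
  mfderiv_symm_mfderiv Φ.symm x a

namespace TrivializationCover

theorem smoothSectionAt (T : TrivializationCover E L J) {α : J} {x : M} (hx : x ∈ T.U α) :
    SmoothSectionAt E (T.s α) x := (T.smooth α).smoothSectionAt (T.U α).isOpen hx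

theorem cov_eq (T : TrivializationCover E L J) {α : J} {x : M} (hx : x ∈ T.U α)
    (a : TangentSpace 𝓘(ℝ, E) x) :
    cov (T.s α) x a = (Complex.I * T.connForm cov α x a) • T.s α x := by
  have h := ratio_smul_self (-Complex.I • cov (T.s α) x a) (T.ne_zero α x hx)
  rw [mul_smul, connForm, h, smul_smul]
  simp

theorem transition_smul (T : TrivializationCover E L J) {α β : J} {x : M} (hβ : x ∈ T.U β) :
    T.transition α β x • T.s β x = T.s α x := ratio_smul_self _ (T.ne_zero β x hβ)

/-- All tangent spaces are copies of `E`, so vectors over propositionally equal base points can be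
compared in `E`. This moves `connForm` along `Φ (Φ.symm x) = x`. -/
theorem connForm_congr (T : TrivializationCover E L J) (α : J) {x y : M} (h : x = y) {a b : E}
    (hab : a = b) : T.connForm cov α x a = T.connForm cov α y b := by
  subst h hab
  rfl

/-- Complementarity is symmetric up to inverting `Φ`; the transfer in the other direction provides
the inverse maps. -/
theorem IsComplementary.symm [IsManifold 𝓘(ℝ, E) ∞ M] {T T' : TrivializationCover E L J}
    (h : T.IsComplementary cov Φ T') : T'.IsComplementary cov Φ.symm T where
  cover_eq α := by
    rw [h.cover_eq, ← preimage_comp, show (Φ ∘ Φ.symm : M → M) = id from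
      funext Φ.apply_symm_apply, preimage_id]
  transition_eq α β x hα hβ := by
    have key : ∀ γ, x ∈ T.U γ → Φ.symm x ∈ T'.U γ := fun γ hγ => by
      rw [← SetLike.mem_coe, h.cover_eq, mem_preimage, Φ.apply_symm_apply]
      exact hγ
    rw [h.transition_eq α β _ (key α hα) (key β hβ), Φ.apply_symm_apply]
  connForm_eq α x hα a := by
    have key : Φ.symm x ∈ T'.U α := by
      rw [← SetLike.mem_coe, h.cover_eq, mem_preimage, Φ.apply_symm_apply]
      exact hα
    rw [h.connForm_eq α _ key]
    exact (T.connForm_congr α (Φ.apply_symm_apply x)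
      (Diffeomorph.mfderiv_mfderiv_symm Φ x a)).symm

theorem IsComplementary.mem_iff {T T' : TrivializationCover E L J}
    (h : T.IsComplementary cov Φ T') {α : J} {y : M} : y ∈ T'.U α ↔ Φ y ∈ T.U α := by
  rw [← SetLike.mem_coe, h.cover_eq]
  rfl

/-- The map `L_x → L_y` with `s_α ↦ t_α`, for a member `U_α` of the cover which contains `x`. -/
def fiberTransfer (T T' : TrivializationCover E L J) (x y : M) (v : L x) : L y :=
  ratio v (T.s (T.cover x).choose x) • T'.s (T.cover x).choose y

/-- The chosen index in `fiberTransfer` does not matter: passing to another member of the cover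
multiplies the coefficient and the frame by inverse factors, since `t` has the transition functions
of `s` at `Φ y`. Linearity and invertibility follow by computing in one frame. -/
theorem IsComplementary.fiberTransfer_eq {T T' : TrivializationCover E L J}
    (h : T.IsComplementary cov Φ T') {x y : M} (hxy : Φ y = x) {β : J} (hβ : x ∈ T.U β) {v : L x}
    {c : ℂ} (hv : v = c • T.s β x) : T.fiberTransfer T' x y v = c • T'.s β y := by
  have hα := (T.cover x).choose_spec
  rw [fiberTransfer]
  set α := (T.cover x).choose
  subst hxy hv
  have hα' := h.mem_iff.2 hα
  rw [← T'.transition_smul (α := β) hα', h.transition_eq β α _ (h.mem_iff.2 hβ) hα', smul_smul]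
  congr 1
  rw [← T.transition_smul (α := β) hα, smul_smul, ratio_smul _ (T.ne_zero α _ hα)]

theorem IsComplementary.fiberTransfer_add {T T' : TrivializationCover E L J}
    (h : T.IsComplementary cov Φ T') {x y : M} (hxy : Φ y = x) (v v' : L x) :
    T.fiberTransfer T' x y (v + v') = T.fiberTransfer T' x y v + T.fiberTransfer T' x y v' := by
  obtain ⟨α, hα⟩ := T.cover x
  have e := fun v => (ratio_smul_self v (T.ne_zero α x hα)).symm
  rw [h.fiberTransfer_eq hxy hα (e v), h.fiberTransfer_eq hxy hα (e v'), ← add_smul]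
  refine h.fiberTransfer_eq hxy hα ?_
  rw [add_smul, ← e, ← e]

theorem IsComplementary.fiberTransfer_smul {T T' : TrivializationCover E L J}
    (h : T.IsComplementary cov Φ T') {x y : M} (hxy : Φ y = x) (c : ℂ) (v : L x) :
    T.fiberTransfer T' x y (c • v) = c • T.fiberTransfer T' x y v := by
  obtain ⟨α, hα⟩ := T.cover x
  have e := fun v => (ratio_smul_self v (T.ne_zero α x hα)).symm
  rw [h.fiberTransfer_eq hxy hα (e v), smul_smul]
  refine h.fiberTransfer_eq hxy hα ?_
  rw [mul_smul, ← e]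

theorem IsComplementary.fiberTransfer_fiberTransfer [IsManifold 𝓘(ℝ, E) ∞ M]
    {T T' : TrivializationCover E L J} (h : T.IsComplementary cov Φ T') {x y : M} (hxy : Φ y = x)
    (v : L x) : T'.fiberTransfer T y x (T.fiberTransfer T' x y v) = v := by
  obtain ⟨α, hα⟩ := T.cover x
  have e := (ratio_smul_self v (T.ne_zero α x hα)).symm
  have hy : y ∈ T'.U α := h.mem_iff.2 (hxy ▸ hα)
  rw [h.symm.fiberTransfer_eq (by rw [← hxy]; exact Φ.symm_apply_apply y) hy
    (h.fiberTransfer_eq hxy hα e), ← e]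

end TrivializationCover

variable [VectorBundle ℝ ℂ L] [ContMDiffVectorBundle ∞ ℂ L 𝓘(ℝ, E)]

theorem mem_parallelSections_of_local (hc : IsComplexLinear cov) {ι : B → M}
    (hι : ContMDiff 𝓘(ℝ, F) 𝓘(ℝ, E) ∞ ι) {τ : ∀ b, L (ι b)}
    (h : ∀ b, ∃ (s : ∀ x, L x) (f : B → ℂ), SmoothSectionAt E s (ι b) ∧
      ContMDiffAt 𝓘(ℝ, F) 𝓘(ℝ, ℂ) ∞ f b ∧ (∀ᶠ b' in 𝓝 b, τ b' = f b' • s (ι b')) ∧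
      ∀ a : TangentSpace 𝓘(ℝ, F) b, mvfderiv 𝓘(ℝ, F) f b a • s (ι b)
        + f b • cov s (ι b) (mfderiv 𝓘(ℝ, F) 𝓘(ℝ, E) ι b a) = 0) :
    τ ∈ parallelSections F cov ι hι := by
  constructor
  · intro b
    obtain ⟨s, f, hs, hf, hτ, -⟩ := h b
    exact SmoothAlongAt.congr ((hs.comp (hι b)).smul hf) hτ
  · intro b a
    obtain ⟨s, f, hs, hf, hτ, h0⟩ := h b
    rw [pullbackCov_smul hc (hι b) hs hf hτ, h0]

/-- This is `ι^*∇ (f s_α) = 0` divided by the nonvanishing `s_α`. Only `f` and the connection form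
occur in it, so it passes to any frame whose connection form pulls back to the same form. -/
theorem mvfderiv_ratio_add_connForm (hc : IsComplexLinear cov) {ι : B → M}
    {hι : ContMDiff 𝓘(ℝ, F) 𝓘(ℝ, E) ∞ ι} {τ : ∀ b, L (ι b)}
    (hτ : τ ∈ parallelSections F cov ι hι) (T : TrivializationCover E L J) {α : J} {b : B}
    (hα : ι b ∈ T.U α) (a : TangentSpace 𝓘(ℝ, F) b) :
    mvfderiv 𝓘(ℝ, F) (fun b => ratio (τ b) (T.s α (ι b))) b a + ratio (τ b) (T.s α (ι b)) *
      (Complex.I * T.connForm cov α (ι b) (mfderiv 𝓘(ℝ, F) 𝓘(ℝ, E) ι b a)) = 0 := by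
  have hs := T.smoothSectionAt hα
  have hne := T.ne_zero α _ hα
  have hf := SmoothAlongAt.ratio (hτ.1 b) (hs.comp (hι b)) hne
  have hev : ∀ᶠ b' in 𝓝 b, τ b' = ratio (τ b') (T.s α (ι b')) • T.s α (ι b') := by
    filter_upwards [(hι b).continuousAt.preimage_mem_nhds ((T.U α).isOpen.mem_nhds hα)] with b' hb'
    exact (ratio_smul_self _ (T.ne_zero α _ hb')).symm
  have h := pullbackCov_smul hc (hι b) hs hf hev a
  rw [hτ.2 b a, T.cov_eq hα, smul_smul, ← add_smul] at h
  exact (smul_eq_zero.1 h.symm).resolve_right hne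

/-- A section `f s_α` of `ι^*L` is sent to the section `(f ∘ G) t_α` of `ι'^*L`. -/
theorem TrivializationCover.IsComplementary.fiberTransfer_mem [IsManifold 𝓘(ℝ, E) ∞ M]
    (hc : IsComplexLinear cov)
    {T T' : TrivializationCover E L J} (h : T.IsComplementary cov Φ T') {ι : B → M}
    (hι : ContMDiff 𝓘(ℝ, F) 𝓘(ℝ, E) ∞ ι) {ι' : B' → M} (hι' : ContMDiff 𝓘(ℝ, F') 𝓘(ℝ, E) ∞ ι')
    {G : B' → B} (hG : ContMDiff 𝓘(ℝ, F') 𝓘(ℝ, F) ∞ G) (hΦ : ∀ b', Φ (ι' b') = ι (G b'))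
    {τ : ∀ b, L (ι b)} (hτ : τ ∈ parallelSections F cov ι hι) :
    (fun b' => T.fiberTransfer T' (ι (G b')) (ι' b') (τ (G b')))
      ∈ parallelSections F' cov ι' hι' := by
  refine mem_parallelSections_of_local hc hι' fun b' => ?_
  obtain ⟨α, hα⟩ := T.cover (ι (G b'))
  have hα' : ι' b' ∈ T'.U α := h.mem_iff.2 (by rw [hΦ]; exact hα)
  have hf := SmoothAlongAt.ratio (hτ.1 (G b')) ((T.smoothSectionAt hα).comp (hι _))
    (T.ne_zero α _ hα)
  refine ⟨T'.s α, fun b' => ratio (τ (G b')) (T.s α (ι (G b'))), T'.smoothSectionAt hα',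
    hf.comp b' (hG b'), ?_, fun a => ?_⟩
  · filter_upwards [(hι.comp hG).continuous.continuousAt.preimage_mem_nhds
      ((T.U α).isOpen.mem_nhds hα)] with c hc
    exact h.fiberTransfer_eq (hΦ c) hc (ratio_smul_self _ (T.ne_zero α _ hc)).symm
  · rw [T'.cov_eq hα', smul_smul, ← add_smul]
    have e1 := mvfderiv_ratio_add_connForm hc hτ T hα (mfderiv 𝓘(ℝ, F') 𝓘(ℝ, F) G b' a)
    have hGd := (hG b').mdifferentiableAt (n := ∞) (by simp)
    have e2 := mvfderiv_comp_apply' (h := fun b => ratio (τ b) (T.s α (ι b)))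
      (hf.mdifferentiableAt (by simp)) hGd a
    -- Both sides are derivatives of the same map `ι ∘ G = Φ ∘ ι'`.
    have e3 : (mfderiv 𝓘(ℝ, F) 𝓘(ℝ, E) ι (G b') (mfderiv 𝓘(ℝ, F') 𝓘(ℝ, F) G b' a) : E)
        = mfderiv 𝓘(ℝ, E) 𝓘(ℝ, E) Φ (ι' b') (mfderiv 𝓘(ℝ, F') 𝓘(ℝ, E) ι' b' a) := by
      have c1 := mfderiv_comp (I := 𝓘(ℝ, F')) (I' := 𝓘(ℝ, F)) (I'' := 𝓘(ℝ, E)) b'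
        (hι.mdifferentiable (by simp) (G b')) hGd
      have c2 := mfderiv_comp (I := 𝓘(ℝ, F')) (I' := 𝓘(ℝ, E)) (I'' := 𝓘(ℝ, E)) b'
        (Φ.contMDiff.mdifferentiable (by simp) (ι' b')) (hι'.mdifferentiable (by simp) b')
      have c3 : (ι ∘ G) = (Φ ∘ ι') := funext fun c => (hΦ c).symm
      have d1 := congrArg (fun S : F' →L[ℝ] E => S a) c1
      have d2 := congrArg (fun S : F' →L[ℝ] E => S a) c2
      refine d1.symm.trans (Eq.trans ?_ d2)
      rw [c3]
    have e4 : T'.connForm cov α (ι' b') (mfderiv 𝓘(ℝ, F') 𝓘(ℝ, E) ι' b' a)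
        = T.connForm cov α (ι (G b'))
          (mfderiv 𝓘(ℝ, F) 𝓘(ℝ, E) ι (G b') (mfderiv 𝓘(ℝ, F') 𝓘(ℝ, F) G b' a)) := by
      rw [h.connForm_eq α _ hα']
      exact T.connForm_congr α (hΦ b') e3.symm
    rw [e2, e4, e1, zero_smul]

/-- The isomorphism of spaces of covariantly constant sections with `f s_α ↦ f t_α`. -/
def TrivializationCover.IsComplementary.parallelEquiv [IsManifold 𝓘(ℝ, E) ∞ M]
    (hc : IsComplexLinear cov)
    {T T' : TrivializationCover E L J} (h : T.IsComplementary cov Φ T') {ι : B → M}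
    (hι : ContMDiff 𝓘(ℝ, F) 𝓘(ℝ, E) ∞ ι) {ι' : B' → M} (hι' : ContMDiff 𝓘(ℝ, F') 𝓘(ℝ, E) ∞ ι')
    (G : B' ≃ₘ^∞⟮𝓘(ℝ, F'), 𝓘(ℝ, F)⟯ B) (hΦ : ∀ b', Φ (ι' b') = ι (G b')) :
    parallelSections F cov ι hι ≃ₗ[ℂ] parallelSections F' cov ι' hι' where
  toFun τ := ⟨_, h.fiberTransfer_mem hc hι hι' G.contMDiff hΦ τ.2⟩
  map_add' τ τ' := Subtype.ext (funext fun b' => h.fiberTransfer_add (hΦ b') _ _)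
  map_smul' c τ := Subtype.ext (funext fun b' => h.fiberTransfer_smul (hΦ b') _ _)
  invFun τ := ⟨_, h.symm.fiberTransfer_mem hc hι' hι G.symm.contMDiff (fun b => by
    rw [← G.apply_symm_apply b, ← hΦ, Φ.symm_apply_apply, G.apply_symm_apply]) τ.2⟩
  left_inv τ := by
    refine Subtype.ext (funext fun b => ?_)
    -- `G (G.symm b)` equals `b` only propositionally while the fibre depends on the point, so the
    -- point is generalized before substituting.
    have key : ∀ c, c = b → T'.fiberTransfer T (ι' (G.symm b)) (ι b)
        (T.fiberTransfer T' (ι c) (ι' (G.symm b)) (τ.1 c)) = τ.1 b := by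
      rintro _ rfl
      exact h.fiberTransfer_fiberTransfer (by rw [hΦ, G.apply_symm_apply]) _
    exact key _ (G.apply_symm_apply b)
  right_inv τ := by
    refine Subtype.ext (funext fun b' => ?_)
    have key : ∀ c, c = b' → T.fiberTransfer T' (ι (G b')) (ι' b')
        (T'.fiberTransfer T (ι' c) (ι (G b')) (τ.1 c)) = τ.1 b' := by
      rintro _ rfl
      refine h.symm.fiberTransfer_fiberTransfer ?_ _
      rw [← hΦ, Φ.symm_apply_apply]
    exact key _ (G.symm_apply_apply b')

theorem TrivializationCover.IsComplementary.parallelEquiv_apply [IsManifold 𝓘(ℝ, E) ∞ M]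
    (hc : IsComplexLinear cov)
    {T T' : TrivializationCover E L J} (h : T.IsComplementary cov Φ T') {ι : B → M}
    (hι : ContMDiff 𝓘(ℝ, F) 𝓘(ℝ, E) ∞ ι) {ι' : B' → M} (hι' : ContMDiff 𝓘(ℝ, F') 𝓘(ℝ, E) ∞ ι')
    (G : B' ≃ₘ^∞⟮𝓘(ℝ, F'), 𝓘(ℝ, F)⟯ B) (hΦ : ∀ b', Φ (ι' b') = ι (G b'))
    (τ : parallelSections F cov ι hι) {α : J} {b' : B'} (hα : ι (G b') ∈ T.U α) {c : ℂ}
    (hτ : τ.1 (G b') = c • T.s α (ι (G b'))) :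
    (h.parallelEquiv hc hι hι' G hΦ τ).1 b' = c • T'.s α (ι' b') :=
  h.fiberTransfer_eq (hΦ b') hα hτ

end Transfer

/-! ### Naturality of polarizations under a symplectomorphism -/

section Pushforward

variable {E : Type v} [NormedAddCommGroup E] [NormedSpace ℝ E] [CompleteSpace E]
  {M : Type u} [TopologicalSpace M] [ChartedSpace E M] [IsManifold 𝓘(ℝ, E) ∞ M]
  {Φ : M ≃ₘ^∞⟮𝓘(ℝ, E), 𝓘(ℝ, E)⟯ M}

theorem Diffeomorph.isInvertible_mfderiv (Φ : M ≃ₘ^∞⟮𝓘(ℝ, E), 𝓘(ℝ, E)⟯ M) (x : M) :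
    (mfderiv 𝓘(ℝ, E) 𝓘(ℝ, E) Φ x).IsInvertible :=
  ⟨Φ.mfderivToContinuousLinearEquiv (by simp) x, rfl⟩

/-- The pullback `Φ^*X` of a vector field. -/
abbrev pullbackField (Φ : M ≃ₘ^∞⟮𝓘(ℝ, E), 𝓘(ℝ, E)⟯ M) (X : ∀ x : M, TangentSpace 𝓘(ℝ, E) x) :
    ∀ x : M, TangentSpace 𝓘(ℝ, E) x :=
  VectorField.mpullback 𝓘(ℝ, E) 𝓘(ℝ, E) Φ X

theorem mfderiv_pullbackField (X : ∀ x : M, TangentSpace 𝓘(ℝ, E) x) (x : M) :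
    mfderiv 𝓘(ℝ, E) 𝓘(ℝ, E) Φ x (pullbackField Φ X x) = X (Φ x) := by
  obtain ⟨A, hA⟩ := Diffeomorph.isInvertible_mfderiv Φ x
  rw [pullbackField, VectorField.mpullback_apply, ← hA, ContinuousLinearMap.inverse_equiv]
  exact A.apply_symm_apply _

theorem mfderiv_injective (x : M) : Function.Injective (mfderiv 𝓘(ℝ, E) 𝓘(ℝ, E) Φ x) := by
  obtain ⟨A, hA⟩ := Diffeomorph.isInvertible_mfderiv Φ x
  rw [← hA]
  exact A.injective

theorem mfderiv_surjective (x : M) : Function.Surjective (mfderiv 𝓘(ℝ, E) 𝓘(ℝ, E) Φ x) := by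
  obtain ⟨A, hA⟩ := Diffeomorph.isInvertible_mfderiv Φ x
  rw [← hA]
  exact A.surjective

theorem pullbackField_symm (X : ∀ x : M, TangentSpace 𝓘(ℝ, E) x) :
    pullbackField Φ (pullbackField Φ.symm X) = X := by
  funext x
  apply mfderiv_injective (Φ := Φ) x
  rw [mfderiv_pullbackField]
  apply mfderiv_injective (Φ := Φ.symm) (Φ x)
  rw [mfderiv_pullbackField]
  have h := mfderiv_symm_mfderiv Φ x (X x)
  refine Eq.trans ?_ h.symm
  have : ∀ y, y = x → (X y : E) = X x := by rintro _ rfl; rfl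
  exact this _ (Φ.symm_apply_apply x)

theorem SmoothVectorFieldOn.pullbackField {U : Set M} {X : ∀ x : M, TangentSpace 𝓘(ℝ, E) x}
    (h : SmoothVectorFieldOn U X) : SmoothVectorFieldOn (Φ ⁻¹' U) (pullbackField Φ X) :=
  ContMDiffOn.mpullback_vectorField_preimage (n := ∞) h Φ.contMDiff
    (fun x _ => Diffeomorph.isInvertible_mfderiv Φ x) (by simp)

theorem IsSectionOn.pullbackField {P : TangentDistribution E M} {U : Set M}
    {X : ∀ x : M, TangentSpace 𝓘(ℝ, E) x} (h : IsSectionOn P U X) :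
    IsSectionOn (transport Φ P) (Φ ⁻¹' U) (pullbackField Φ X) := by
  refine ⟨h.1.pullbackField, fun x hx => ?_⟩
  change mfderiv 𝓘(ℝ, E) 𝓘(ℝ, E) Φ x (GeomQuant.pullbackField Φ X x) ∈ P (Φ x)
  rw [mfderiv_pullbackField]
  exact h.2 _ hx

theorem transport_symm_transport (Φ : M ≃ₘ^∞⟮𝓘(ℝ, E), 𝓘(ℝ, E)⟯ M) (P : TangentDistribution E M) :
    transport Φ.symm (transport Φ P) = P := by
  funext x
  ext a
  have key : ∀ (y : M) (c : E), y = x → c = a →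
      (c ∈ (P y : Submodule ℝ E) ↔ a ∈ (P x : Submodule ℝ E)) := by
    rintro _ _ rfl rfl
    rfl
  exact key _ _ (Φ.apply_symm_apply x) (mfderiv_symm_mfderiv Φ.symm x a)

theorem preimage_symm_preimage (U : Set M) : Φ.symm ⁻¹' (Φ ⁻¹' U) = U := by
  ext x
  simp

theorem IsSectionOn.pullbackField_symm {P : TangentDistribution E M} {U : Set M}
    {X : ∀ x : M, TangentSpace 𝓘(ℝ, E) x} (h : IsSectionOn (transport Φ P) U X) :
    IsSectionOn P (Φ.symm ⁻¹' U) (GeomQuant.pullbackField Φ.symm X) := by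
  have h1 := IsSectionOn.pullbackField (Φ := Φ.symm) h
  rwa [transport_symm_transport] at h1

theorem IsSectionOn.congr {P : TangentDistribution E M} {U : Set M}
    {X Y : ∀ x : M, TangentSpace 𝓘(ℝ, E) x} (h : IsSectionOn P U X) (he : ∀ x ∈ U, Y x = X x) :
    IsSectionOn P U Y := by
  refine ⟨ContMDiffOn.congr (f := fun x => (⟨x, X x⟩ : TangentBundle 𝓘(ℝ, E) M)) h.1
    fun x hx => ?_, fun x hx => ?_⟩
  · rw [he x hx]
  · rw [he x hx]
    exact h.2 x hx

theorem SmoothVectorFieldOn.mdifferentiableAt {U : Set M} (hU : IsOpen U)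
    {X : ∀ x : M, TangentSpace 𝓘(ℝ, E) x} (h : SmoothVectorFieldOn U X) {x : M} (hx : x ∈ U) :
    MDifferentiableAt 𝓘(ℝ, E) 𝓘(ℝ, E).tangent
      (fun x => (⟨x, X x⟩ : TangentBundle 𝓘(ℝ, E) M)) x :=
  (ContMDiffOn.contMDiffAt h (hU.mem_nhds hx)).mdifferentiableAt (by simp)

theorem pullbackField_mlieBracket {U : Set M} (hU : IsOpen U)
    {X Y : ∀ x : M, TangentSpace 𝓘(ℝ, E) x} (hX : SmoothVectorFieldOn U X)
    (hY : SmoothVectorFieldOn U Y) {x : M} (hx : Φ x ∈ U) :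
    pullbackField Φ (VectorField.mlieBracket 𝓘(ℝ, E) X Y) x
      = VectorField.mlieBracket 𝓘(ℝ, E) (pullbackField Φ X) (pullbackField Φ Y) x := by
  have : IsManifold 𝓘(ℝ, E) (minSmoothness ℝ 2) M := by
    rw [minSmoothness_of_isRCLikeNormedField]
    infer_instance
  exact VectorField.mpullback_mlieBracket (n := ∞) (hX.mdifferentiableAt hU hx)
    (hY.mdifferentiableAt hU hx) (Φ.contMDiff x)
    (by rw [minSmoothness_of_isRCLikeNormedField]; exact ENat.LEInfty.out)

/-- Pullback by `Φ` turns sections of `P` over `U` into sections of `Φ(P)` over `Φ⁻¹(U)`, with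
inverse pullback by `Φ⁻¹`, and it commutes with brackets and with combinations over functions. The
Lagrangian condition is carried over by `Φ^*Ω = Ω`. -/
theorem IsPolarization.transport {Ω : BilinField E M} {P : TangentDistribution E M}
    (hP : IsPolarization Ω P) (hΦ : IsSymplectomorphism Ω Φ) :
    IsPolarization Ω (transport Φ P) where
  smooth x a ha := by
    obtain ⟨U, hU, hx, X, hX, hXa⟩ := hP.smooth (Φ x) (mfderiv 𝓘(ℝ, E) 𝓘(ℝ, E) Φ x a) ha
    refine ⟨Φ ⁻¹' U, hU.preimage Φ.continuous, hx, pullbackField Φ X, hX.pullbackField, ?_⟩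
    apply mfderiv_injective (Φ := Φ) x
    rw [mfderiv_pullbackField, hXa]
  involutive U hU X Y hX hY := by
    have hV : IsOpen (Φ.symm ⁻¹' U) := hU.preimage Φ.symm.continuous
    -- The sections are moved to `P`, bracketed there, and the bracket is moved back.
    have h := (hP.involutive _ hV _ _ hX.pullbackField_symm hY.pullbackField_symm).pullbackField
      (Φ := Φ)
    have hU' : Φ ⁻¹' (Φ.symm ⁻¹' U) = U := by
      ext x
      simp
    rw [hU'] at h
    refine h.congr fun x hx => ?_
    rw [pullbackField_mlieBracket hV hX.pullbackField_symm.1 hY.pullbackField_symm.1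
      (by simpa using hx), pullbackField_symm, pullbackField_symm]
  locally_finitely_generated x := by
    obtain ⟨U, hU, hx, k, X, hX, hgen⟩ := hP.locally_finitely_generated (Φ x)
    refine ⟨Φ ⁻¹' U, hU.preimage Φ.continuous, hx, k, fun i => pullbackField Φ (X i),
      fun i => (hX i).pullbackField, fun Y hY => ?_⟩
    have hY' := hY.pullbackField_symm
    rw [preimage_symm_preimage] at hY'
    obtain ⟨f, hf, hfY⟩ := hgen _ hY'
    refine ⟨fun i y => f i (Φ y), fun i => (hf i).comp Φ.contMDiff.contMDiffOn fun y hy => hy,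
      fun y hy => ?_⟩
    apply mfderiv_injective (Φ := Φ) y
    rw [map_sum]
    simp only [map_smul, mfderiv_pullbackField]
    rw [← hfY _ hy]
    conv_lhs => rw [← pullbackField_symm (Φ := Φ) Y, mfderiv_pullbackField]
  lagrangian := by
    obtain ⟨U, hU, hd, h⟩ := hP.lagrangian
    refine ⟨Φ ⁻¹' U, hU.preimage Φ.continuous,
      hd.preimage Φ.toHomeomorph.isOpenMap, fun x hx a => (h _ hx _).trans ?_⟩
    constructor
    · intro h1 b hb
      rw [← hΦ]
      exact h1 _ hb
    · intro h1 b hb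
      obtain ⟨b, rfl⟩ := mfderiv_surjective (Φ := Φ) x b
      exact (hΦ x a b).trans (h1 b hb)

end Pushforward

/-! ### Coordinate vector fields of a smooth chart -/

section CoordinateFields

variable {E : Type v} [NormedAddCommGroup E] [NormedSpace ℝ E] [CompleteSpace E]
  {M : Type u} [TopologicalSpace M] [ChartedSpace E M] [IsManifold 𝓘(ℝ, E) ∞ M]

/-- `e` is a smooth chart of `M`. -/
structure IsSmoothChart (e : OpenPartialHomeomorph M E) : Prop where
  smooth : ContMDiffOn 𝓘(ℝ, E) 𝓘(ℝ, E) ∞ e e.source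
  smooth_symm : ContMDiffOn 𝓘(ℝ, E) 𝓘(ℝ, E) ∞ e.symm e.target

variable {e : OpenPartialHomeomorph M E}

theorem IsSmoothChart.mdifferentiable (he : IsSmoothChart e) :
    e.MDifferentiable 𝓘(ℝ, E) 𝓘(ℝ, E) :=
  ⟨he.smooth.mdifferentiableOn (by simp), he.smooth_symm.mdifferentiableOn (by simp)⟩

theorem IsSmoothChart.contMDiffAt (he : IsSmoothChart e) {x : M} (hx : x ∈ e.source) :
    ContMDiffAt 𝓘(ℝ, E) 𝓘(ℝ, E) ∞ e x := he.smooth.contMDiffAt (e.open_source.mem_nhds hx)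

theorem IsSmoothChart.contMDiffAt_symm (he : IsSmoothChart e) {z : E} (hz : z ∈ e.target) :
    ContMDiffAt 𝓘(ℝ, E) 𝓘(ℝ, E) ∞ e.symm z :=
  he.smooth_symm.contMDiffAt (e.open_target.mem_nhds hz)

/-- The constant vector field on `E` with value `v`. -/
def constField (v : E) : ∀ z : E, TangentSpace 𝓘(ℝ, E) z := fun _ => v

/-- The coordinate vector field of the chart `e` in the direction `v`. -/
def coordField (e : OpenPartialHomeomorph M E) (v : E) : ∀ x : M, TangentSpace 𝓘(ℝ, E) x :=
  VectorField.mpullback 𝓘(ℝ, E) 𝓘(ℝ, E) e (constField v)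

theorem IsSmoothChart.coordField_eq (he : IsSmoothChart e) {x : M} (hx : x ∈ e.source) (v : E) :
    coordField e v x = mfderiv 𝓘(ℝ, E) 𝓘(ℝ, E) e.symm (e x) v := by
  have h : mfderiv 𝓘(ℝ, E) 𝓘(ℝ, E) e x = (he.mdifferentiable.mfderiv hx :
    TangentSpace 𝓘(ℝ, E) x →L[ℝ] TangentSpace 𝓘(ℝ, E) (e x)) := rfl
  rw [coordField, VectorField.mpullback_apply, h, ContinuousLinearMap.inverse_equiv]
  rfl

theorem IsSmoothChart.mfderiv_coordField (he : IsSmoothChart e) {x : M} (hx : x ∈ e.source)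
    (v : E) : mfderiv 𝓘(ℝ, E) 𝓘(ℝ, E) e x (coordField e v x) = v := by
  rw [he.coordField_eq hx]
  exact (he.mdifferentiable.mfderiv hx).apply_symm_apply v

theorem IsSmoothChart.coordField_mfderiv (he : IsSmoothChart e) {x : M} (hx : x ∈ e.source)
    (a : TangentSpace 𝓘(ℝ, E) x) :
    coordField e (mfderiv 𝓘(ℝ, E) 𝓘(ℝ, E) e x a : E) x = a := by
  exact (he.coordField_eq hx _).trans ((he.mdifferentiable.mfderiv hx).symm_apply_apply a)

theorem IsSmoothChart.isInvertible_mfderiv (he : IsSmoothChart e) {x : M} (hx : x ∈ e.source) :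
    (mfderiv 𝓘(ℝ, E) 𝓘(ℝ, E) e x).IsInvertible := ⟨he.mdifferentiable.mfderiv hx, rfl⟩

theorem contMDiffAt_const_field (v : E) (z : E) :
    ContMDiffAt 𝓘(ℝ, E) 𝓘(ℝ, E).tangent ∞
      (fun z => (⟨z, constField v z⟩ : TangentBundle 𝓘(ℝ, E) E)) z :=
  contMDiffAt_vectorSpace_iff_contDiffAt.2 (contDiffAt_const (c := v))

theorem IsSmoothChart.smooth_coordField (he : IsSmoothChart e) (v : E) :
    SmoothVectorFieldOn e.source (coordField e v) := fun x hx =>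
  (ContMDiffAt.mpullback_vectorField_preimage (n := ∞) (contMDiffAt_const_field v (e x))
    (he.contMDiffAt hx) (he.isInvertible_mfderiv hx) (by simp)).contMDiffWithinAt

/-- Constant fields on `E` commute and pullback respects brackets. On coordinate fields the
curvature identity therefore loses its bracket term. -/
theorem IsSmoothChart.mlieBracket_coordField (he : IsSmoothChart e) {x : M} (hx : x ∈ e.source)
    (u v : E) : VectorField.mlieBracket 𝓘(ℝ, E) (coordField e u) (coordField e v) x = 0 := by
  have : IsManifold 𝓘(ℝ, E) (minSmoothness ℝ 2) M := by
    rw [minSmoothness_of_isRCLikeNormedField]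
    infer_instance
  have h := VectorField.mpullback_mlieBracket (n := ∞) (I := 𝓘(ℝ, E)) (I' := 𝓘(ℝ, E)) (f := e)
    ((contMDiffAt_const_field u (e x)).mdifferentiableAt (by simp))
    ((contMDiffAt_const_field v (e x)).mdifferentiableAt (by simp)) (he.contMDiffAt hx)
    (by rw [minSmoothness_of_isRCLikeNormedField]; exact ENat.LEInfty.out)
  refine h.symm.trans ?_
  have h0 : VectorField.mlieBracket 𝓘(ℝ, E) (constField u) (constField v) (e x) = 0 := by
    rw [← VectorField.mlieBracketWithin_univ, VectorField.mlieBracketWithin_eq_lieBracketWithin]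
    change VectorField.lieBracketWithin ℝ (fun _ : E => u) (fun _ : E => v) univ (e x) = 0
    simp [VectorField.lieBracketWithin]
  rw [VectorField.mpullback_apply, h0, map_zero]

end CoordinateFields

/-! ### Connection forms in coordinates and their curvature -/

section ConnectionForms

variable {E : Type v} [NormedAddCommGroup E] [NormedSpace ℝ E]
  {M : Type u} [TopologicalSpace M] [ChartedSpace E M]
  {L : M → Type w} [TopologicalSpace (TotalSpace ℂ L)]
  [∀ x, TopologicalSpace (L x)] [∀ x, AddCommGroup (L x)] [∀ x, Module ℂ (L x)]
  [∀ x, IsTopologicalAddGroup (L x)] [∀ x, ContinuousSMul ℝ (L x)]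
  [FiberBundle ℂ L] [VectorBundle ℂ ℂ L]

theorem ratio_add_left {x : M} (a a' b : L x) : ratio (a + a') b = ratio a b + ratio a' b := by
  unfold ratio
  rw [← add_div]
  congr 1
  exact (coord_isLinear (mem_baseSet_trivializationAt ℂ L x)).map_add a a'

theorem ratio_smul_left {x : M} (c : ℂ) (a b : L x) : ratio (c • a) b = c * ratio a b := by
  unfold ratio
  rw [coord_smul_apply (mem_baseSet_trivializationAt ℂ L x), mul_div_assoc]

/-- The connection one-form of the local frame `s`, with `∇ s = i θ s`. -/
def frameForm (cov : CovariantDerivative 𝓘(ℝ, E) ℂ L) (s : ∀ x, L x) (x : M) :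
    TangentSpace 𝓘(ℝ, E) x →ₗ[ℝ] ℂ where
  toFun a := ratio (-Complex.I • cov s x a) (s x)
  map_add' a b := by rw [map_add, smul_add, ratio_add_left]
  map_smul' c a := by
    have h : (cov s x (c • a) : L x) = (c : ℂ) • cov s x a := map_smul _ _ _
    rw [h, smul_comm, ratio_smul_left]
    rfl

theorem cov_eq_frameForm_smul {cov : CovariantDerivative 𝓘(ℝ, E) ℂ L} {s : ∀ x, L x} {x : M}
    (hs : s x ≠ 0) (a : TangentSpace 𝓘(ℝ, E) x) :
    cov s x a = (Complex.I * frameForm cov s x a) • s x := by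
  have h : frameForm cov s x a • s x = -Complex.I • cov s x a := ratio_smul_self _ hs
  rw [mul_smul, h, smul_smul]
  simp

variable [IsManifold 𝓘(ℝ, E) ∞ M] [T2Space M] [FiniteDimensional ℝ E] [VectorBundle ℝ ℂ L]
  [ContMDiffVectorBundle ∞ ℂ L 𝓘(ℝ, E)]

/-- Smoothness of the connection is applied to a globally smooth section: `s` times a bump function
supported in `U` and equal to `1` near `x`. Near `x` both sections have the same covariant
derivative, by locality. -/
theorem contMDiffAt_cov {cov : CovariantDerivative 𝓘(ℝ, E) ℂ L}
    (hcov : cov.ContMDiffCovariantDerivative ∞) {U : Set M} (hU : IsOpen U) {s : ∀ x, L x}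
    (hs : SmoothSectionOn (E := E) U s) {x : M} (hx : x ∈ U) :
    ContMDiffAt 𝓘(ℝ, E) (𝓘(ℝ, E).prod 𝓘(ℝ, E →L[ℝ] ℂ)) ∞
      (fun y => (⟨y, cov s y⟩ :
        TotalSpace (E →L[ℝ] ℂ) fun y : M => TangentSpace 𝓘(ℝ, E) y →L[ℝ] L y)) x := by
  obtain ⟨f, -, hf⟩ := (SmoothBumpFunction.nhds_basis_tsupport (I := 𝓘(ℝ, E)) x).mem_iff.1
    (hU.mem_nhds hx)
  have h1 : ContMDiff 𝓘(ℝ, E) (𝓘(ℝ, E).prod 𝓘(ℝ, ℂ)) ∞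
      (fun y => TotalSpace.mk' ℂ y (((f : M → ℝ) • s) y)) :=
    ContMDiffOn.smul_section_of_tsupport f.contMDiff.contMDiffOn hU hf hs
  have h2 := hcov.contMDiff.contMDiff (σ := (f : M → ℝ) • s)
    (by simpa using h1.contMDiffOn)
  refine (h2.contMDiffAt Filter.univ_mem).congr_of_eventuallyEq ?_
  filter_upwards [f.eventuallyEq_one.eventuallyEq_nhds, hU.mem_nhds hx] with y hy hyU
  have : cov s y = cov ((f : M → ℝ) • s) y := by
    refine (cov_congr (hs.smoothSectionAt hU hyU) ?_).symm
    filter_upwards [hy] with y' hy'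
    change f y' • s y' = s y'
    rw [hy', Pi.one_apply, one_smul]
  exact congrArg (fun T => (⟨y, T⟩ :
        TotalSpace (E →L[ℝ] ℂ) fun y : M => TangentSpace 𝓘(ℝ, E) y →L[ℝ] L y)) this

theorem smoothSectionAt_cov {cov : CovariantDerivative 𝓘(ℝ, E) ℂ L}
    (hcov : cov.ContMDiffCovariantDerivative ∞) {U : Set M} (hU : IsOpen U) {s : ∀ x, L x}
    (hs : SmoothSectionOn (E := E) U s) {X : ∀ x : M, TangentSpace 𝓘(ℝ, E) x}
    (hX : SmoothVectorFieldOn U X) {x : M} (hx : x ∈ U) :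
    SmoothSectionAt E (fun y => cov s y (X y)) x :=
  ContMDiffAt.clm_bundle_apply (contMDiffAt_cov hcov hU hs hx)
    (ContMDiffOn.contMDiffAt hX (hU.mem_nhds hx))

/-- The connection one-form of the frame `s` in the coordinates `e`. -/
def coordForm (cov : CovariantDerivative 𝓘(ℝ, E) ℂ L) (e : OpenPartialHomeomorph M E)
    (s : ∀ x, L x) (z : E) : E →L[ℝ] ℂ :=
  LinearMap.toContinuousLinearMap ((frameForm cov s (e.symm z)).comp
    (mfderiv 𝓘(ℝ, E) 𝓘(ℝ, E) e.symm z).toLinearMap : E →ₗ[ℝ] ℂ)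

theorem coordForm_apply (cov : CovariantDerivative 𝓘(ℝ, E) ℂ L) (e : OpenPartialHomeomorph M E)
    (s : ∀ x, L x) (z v : E) : coordForm cov e s z v
      = frameForm cov s (e.symm z) (mfderiv 𝓘(ℝ, E) 𝓘(ℝ, E) e.symm z v) := rfl

variable {e : OpenPartialHomeomorph M E}

theorem coordForm_apply_chart {cov : CovariantDerivative 𝓘(ℝ, E) ℂ L} (he : IsSmoothChart e)
    (s : ∀ x, L x) {x : M} (hx : x ∈ e.source) (v : E) :
    coordForm cov e s (e x) v = frameForm cov s x (coordField e v x) := by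
  have : CompleteSpace E := FiniteDimensional.complete ℝ E
  rw [coordForm_apply, he.coordField_eq hx]
  have key : ∀ y, y = x → ∀ a : E, frameForm cov s y a = frameForm cov s x a := by
    rintro _ rfl a
    rfl
  exact key _ (e.left_inv hx) _

theorem contMDiffAt_frameForm {cov : CovariantDerivative 𝓘(ℝ, E) ℂ L}
    (hcov : cov.ContMDiffCovariantDerivative ∞) {U : Set M} (hU : IsOpen U) {s : ∀ x, L x}
    (hs : SmoothSectionOn (E := E) U s) {X : ∀ x : M, TangentSpace 𝓘(ℝ, E) x}
    (hX : SmoothVectorFieldOn U X) {x : M} (hx : x ∈ U) (h0 : s x ≠ 0) :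
    ContMDiffAt 𝓘(ℝ, E) 𝓘(ℝ, ℂ) ∞ (fun y => frameForm cov s y (X y)) x :=
  SmoothAlongAt.ratio ((smoothSectionAt_cov hcov hU hs hX hx).smul
    (contMDiffAt_const (c := -Complex.I))) (hs.smoothSectionAt hU hx) h0

/-- As `E` is finite-dimensional, smoothness may be tested on each fixed vector `v`. There the form
is the quotient of `-i ∇ s` along the coordinate field of `v` by `s`. -/
theorem contDiffOn_coordForm {cov : CovariantDerivative 𝓘(ℝ, E) ℂ L}
    (hcov : cov.ContMDiffCovariantDerivative ∞) (he : IsSmoothChart e) {s : ∀ x, L x}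
    (hs : SmoothSectionOn (E := E) e.source s) (h0 : ∀ x ∈ e.source, s x ≠ 0) :
    ContDiffOn ℝ ∞ (coordForm cov e s) e.target := by
  have : CompleteSpace E := FiniteDimensional.complete ℝ E
  rw [contDiffOn_clm_apply]
  intro v z hz
  have hx := e.map_target hz
  have h1 := contMDiffAt_frameForm hcov e.open_source hs (he.smooth_coordField v) hx (h0 _ hx)
  have h2 : ContDiffAt ℝ ∞ (fun z => frameForm cov s (e.symm z) (coordField e v (e.symm z))) z :=
    (h1.comp z (he.contMDiffAt_symm hz)).contDiffAt
  refine (h2.congr_of_eventuallyEq ?_).contDiffWithinAt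
  filter_upwards [e.open_target.mem_nhds hz] with z' hz'
  rw [← coordForm_apply_chart he s (e.map_target hz'), e.right_inv hz']

variable {Ω : BilinField E M}

/-- In coordinates, the curvature of the connection is the derivative of its connection form. -/
theorem fderiv_coordForm_sub (Q : PrequantumStructure L Ω) (he : IsSmoothChart e) {s : ∀ x, L x}
    (hs : SmoothSectionOn (E := E) e.source s) (h0 : ∀ x ∈ e.source, s x ≠ 0) {x : M}
    (hx : x ∈ e.source) (u v : E) :
    fderiv ℝ (coordForm Q.cov e s) (e x) u v - fderiv ℝ (coordForm Q.cov e s) (e x) v u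
      = (Ω x (coordField e u x) (coordField e v x) : ℂ) := by
  have : CompleteSpace E := FiniteDimensional.complete ℝ E
  have hω := contDiffOn_coordForm Q.cov_smooth he hs h0
  have hωd : DifferentiableAt ℝ (coordForm Q.cov e s) (e x) :=
    (hω.contDiffAt (e.open_target.mem_nhds (e.map_source hx))).differentiableAt (by simp)
  have hc : IsComplexLinear Q.cov := Q.cov_complex
  have hsx := hs.smoothSectionAt e.open_source hx
  -- With `∇ s = i ω s`, this is `∇_u (i ω(v) s) = (i ω(v)) (i ω(u)) s + i (∂_u ω)(v) s`. The
  -- quadratic term is symmetric in `u` and `v`, so it cancels in the curvature and `dω` remains.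
  have second : ∀ u v : E, Q.cov (fun y => Q.cov s y (coordField e v y)) x (coordField e u x)
      = (Complex.I * coordForm Q.cov e s (e x) v) •
          (Complex.I * coordForm Q.cov e s (e x) u) • s x
        + (Complex.I * fderiv ℝ (coordForm Q.cov e s) (e x) u v) • s x := by
    intro u v
    have hf : ContMDiffAt 𝓘(ℝ, E) 𝓘(ℝ, ℂ) ∞
        (fun y => Complex.I * frameForm Q.cov s y (coordField e v y)) x :=
      contMDiffAt_mul_complex contMDiffAt_const
        (contMDiffAt_frameForm Q.cov_smooth e.open_source hs (he.smooth_coordField v) hx (h0 x hx))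
    have hcg : Q.cov (fun y => Q.cov s y (coordField e v y)) x
        = Q.cov (fun y => (Complex.I * frameForm Q.cov s y (coordField e v y)) • s y) x := by
      refine cov_congr (SmoothAlongAt.smul hsx hf) ?_
      filter_upwards [e.open_source.mem_nhds hx] with y hy
      exact cov_eq_frameForm_smul (h0 y hy) _
    rw [hcg, hc.leibniz hsx hf, cov_eq_frameForm_smul (h0 x hx), ← coordForm_apply_chart he s hx,
      ← coordForm_apply_chart he s hx]
    congr 2
    have hT : HasFDerivAt (fun z => Complex.I * coordForm Q.cov e s z v)
        (Complex.I • ((ContinuousLinearMap.apply ℝ ℂ v).comp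
          (fderiv ℝ (coordForm Q.cov e s) (e x)))) (e x) :=
      (((ContinuousLinearMap.apply ℝ ℂ v).hasFDerivAt).comp (e x) hωd.hasFDerivAt).const_smul
        Complex.I
    have hev : (fun y => Complex.I * frameForm Q.cov s y (coordField e v y)) =ᶠ[𝓝 x]
        fun y => (fun z => Complex.I * coordForm Q.cov e s z v) (e y) := by
      filter_upwards [e.open_source.mem_nhds hx] with y hy
      rw [← coordForm_apply_chart he s hy]
    rw [mvfderiv_congr hev, mvfderiv_comp_apply' hT.differentiableAt.mdifferentiableAt
      ((he.contMDiffAt hx).mdifferentiableAt (by simp)), he.mfderiv_coordField hx]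
    have hm : mvfderiv 𝓘(ℝ, E) (fun z => Complex.I * coordForm Q.cov e s z v) (e x) u
        = (mfderiv 𝓘(ℝ, E) 𝓘(ℝ, ℂ) (fun z => Complex.I * coordForm Q.cov e s z v) (e x) :
          E →L[ℝ] ℂ) u := rfl
    rw [hm, mfderiv_eq_fderiv, hT.fderiv]
    rfl
  have hcurv := Q.curvature e.source e.open_source _ _ (he.smooth_coordField u)
    (he.smooth_coordField v) s hs x hx
  rw [he.mlieBracket_coordField hx, map_zero, sub_zero, second, second] at hcurv
  have h2 : (Complex.I * (fderiv ℝ (coordForm Q.cov e s) (e x) u v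
      - fderiv ℝ (coordForm Q.cov e s) (e x) v u)) • s x
      = (Complex.I * (Ω x (coordField e u x) (coordField e v x) : ℂ)) • s x := by
    rw [← hcurv]
    module
  exact mul_left_cancel₀ Complex.I_ne_zero (smul_left_injective ℂ (h0 x hx) h2)

end ConnectionForms

/-! ### Local frames with the pulled back connection form -/

section LocalFrames

variable {E : Type v} [NormedAddCommGroup E] [NormedSpace ℝ E]
  {M : Type u} [TopologicalSpace M] [ChartedSpace E M] [IsManifold 𝓘(ℝ, E) ∞ M]
  {Φ : M ≃ₘ^∞⟮𝓘(ℝ, E), 𝓘(ℝ, E)⟯ M}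

/-- The chart at `x` is cut down to the preimage of a small ball. Convexity serves the Poincaré
lemma and the constancy of functions with zero derivative. -/
theorem exists_convex_chart {x : M} {N : Set M} (hN : N ∈ 𝓝 x) :
    ∃ e : OpenPartialHomeomorph M E, IsSmoothChart e ∧ x ∈ e.source ∧ e.source ⊆ N ∧
      Convex ℝ e.target := by
  set c := chartAt E x with hc
  have hx : x ∈ c.source := mem_chart_source E x
  have h1 : c.target ∩ c.symm ⁻¹' N ∈ 𝓝 (c x) :=
    Filter.inter_mem (c.open_target.mem_nhds (c.map_source hx))
      ((c.continuousAt_symm (c.map_source hx)).preimage_mem_nhds (by rwa [c.left_inv hx]))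
  obtain ⟨r, hr, hball⟩ := Metric.mem_nhds_iff.1 h1
  set e := (c.symm.restrOpen (Metric.ball (c x) r) Metric.isOpen_ball).symm with he
  have htgt : e.target = Metric.ball (c x) r := by
    rw [he, OpenPartialHomeomorph.symm_target, OpenPartialHomeomorph.restrOpen_source]
    exact inter_eq_right.2 fun z hz => (hball hz).1
  have hsub : e.source ⊆ c.source ∩ N := fun y hy => by
    have hz := e.map_source hy
    have hy' : c.symm (e y) = y := e.left_inv hy
    rw [htgt] at hz
    have h2 := hball hz
    rw [← hy']
    exact ⟨c.map_target h2.1, h2.2⟩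
  refine ⟨e, ⟨?_, ?_⟩, ?_, hsub.trans inter_subset_right, htgt ▸ convex_ball _ _⟩
  · exact (contMDiffOn_chart (I := 𝓘(ℝ, E)) (x := x)).mono (hsub.trans inter_subset_left)
  · refine (contMDiffOn_chart_symm (I := 𝓘(ℝ, E)) (x := x)).mono ?_
    rw [htgt]
    exact fun z hz => (hball hz).1
  · have h3 : c x ∈ e.target := by
      rw [htgt]
      exact Metric.mem_ball_self hr
    have h4 := e.map_target h3
    have h5 : e.symm (c x) = x := c.left_inv hx
    rwa [h5] at h4

/-- The chart `e ∘ Φ⁻¹`. -/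
abbrev chartTransport (Φ : M ≃ₘ^∞⟮𝓘(ℝ, E), 𝓘(ℝ, E)⟯ M) (e : OpenPartialHomeomorph M E) :
    OpenPartialHomeomorph M E :=
  Φ.symm.toHomeomorph.transOpenPartialHomeomorph e

variable {e : OpenPartialHomeomorph M E}

theorem IsSmoothChart.chartTransport (he : IsSmoothChart e) :
    IsSmoothChart (chartTransport Φ e) where
  smooth := he.smooth.comp Φ.symm.contMDiff.contMDiffOn fun _ hx => hx
  smooth_symm := Φ.contMDiff.comp_contMDiffOn he.smooth_symm

theorem mem_chartTransport_source {x : M} (hx : x ∈ e.source) :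
    Φ x ∈ (chartTransport Φ e).source := by
  change Φ.symm (Φ x) ∈ e.source
  rwa [Φ.symm_apply_apply]

theorem chartTransport_apply (x : M) : chartTransport Φ e (Φ x) = e x :=
  congrArg e (Φ.symm_apply_apply x)

/-- In the charts `e` and `e ∘ Φ⁻¹` the map `Φ` is the identity of `e.target`. The form at `Φ x` and
the form at `x` thus become forms on one convex subset of `E`, and can be subtracted. -/
theorem IsSmoothChart.coordField_chartTransport [CompleteSpace E] (he : IsSmoothChart e) {x : M}
    (hx : x ∈ e.source) (v : E) :
    coordField (GeomQuant.chartTransport Φ e) v (Φ x)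
      = mfderiv 𝓘(ℝ, E) 𝓘(ℝ, E) Φ x (coordField e v x) := by
  have h1 : (coordField (GeomQuant.chartTransport Φ e) v (Φ x) : E)
      = mfderiv 𝓘(ℝ, E) 𝓘(ℝ, E) (Φ ∘ e.symm) (GeomQuant.chartTransport Φ e (Φ x)) v :=
    he.chartTransport.coordField_eq (mem_chartTransport_source hx) v
  have h2 := mfderiv_comp (I := 𝓘(ℝ, E)) (I' := 𝓘(ℝ, E)) (I'' := 𝓘(ℝ, E)) (e x)
    (Φ.contMDiff.mdifferentiable (by simp) (e.symm (e x)))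
    ((he.contMDiffAt_symm (e.map_source hx)).mdifferentiableAt (by simp))
  have h3 := congrArg (fun T : E →L[ℝ] E => T v) h2
  have h4 : ∀ z, z = e x → (mfderiv 𝓘(ℝ, E) 𝓘(ℝ, E) (Φ ∘ e.symm) z v : E)
      = mfderiv 𝓘(ℝ, E) 𝓘(ℝ, E) (Φ ∘ e.symm) (e x) v := by
    rintro _ rfl
    rfl
  have h5 : ∀ (y : M) (a b : E), y = x → a = b → (mfderiv 𝓘(ℝ, E) 𝓘(ℝ, E) Φ y a : E)
      = mfderiv 𝓘(ℝ, E) 𝓘(ℝ, E) Φ x b := by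
    rintro _ _ _ rfl rfl
    rfl
  exact h1.trans ((h4 _ (chartTransport_apply x)).trans (h3.trans
    (h5 _ _ _ (e.left_inv hx) (he.coordField_eq hx v).symm)))

variable {L : M → Type w} [TopologicalSpace (TotalSpace ℂ L)]
  [∀ x, TopologicalSpace (L x)] [∀ x, AddCommGroup (L x)] [∀ x, Module ℂ (L x)]
  [∀ x, IsTopologicalAddGroup (L x)] [∀ x, ContinuousSMul ℝ (L x)]
  [FiberBundle ℂ L] [VectorBundle ℂ ℂ L] [VectorBundle ℝ ℂ L]
  [ContMDiffVectorBundle ∞ ℂ L 𝓘(ℝ, E)] [FiniteDimensional ℝ E] [T2Space M]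
  {Ω : BilinField E M}

/-- A closed one-form on a convex open set has a smooth primitive. -/
theorem exists_contDiffOn_primitive {s : Set E} (hs : Convex ℝ s) (ho : IsOpen s)
    {β : E → E →L[ℝ] ℂ} (hβ : ContDiffOn ℝ ∞ β s)
    (hsymm : ∀ z ∈ s, ∀ u v, fderiv ℝ β z u v = fderiv ℝ β z v u) :
    ∃ f : E → ℂ, ContDiffOn ℝ ∞ f s ∧ ∀ z ∈ s, HasFDerivAt f (β z) z := by
  obtain ⟨f, hf⟩ := hs.exists_forall_hasFDerivAt_of_fderiv_symmetric ho
    (hβ.differentiableOn (by simp)) hsymm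
  refine ⟨f, (contDiffOn_infty_iff_fderiv_of_isOpen ho).2
    ⟨fun z hz => (hf z hz).differentiableAt.differentiableWithinAt, ?_⟩, hf⟩
  exact hβ.congr fun z hz => (hf z hz).fderiv

/-- If `s` is a frame near `Φ x`, then near `x` there is a frame whose connection form is the
pullback under `Φ` of the connection form of `s`. -/
theorem exists_frame_pullback (Q : PrequantumStructure L Ω) (hΦ : IsSymplectomorphism Ω Φ)
    {s : ∀ x, L x} {U : Set M} (hU : IsOpen U) (hs : SmoothSectionOn (E := E) U s)
    (h0 : ∀ x ∈ U, s x ≠ 0) {x : M} (hx : Φ x ∈ U) :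
    ∃ V : Set M, IsOpen V ∧ x ∈ V ∧ V ⊆ Φ ⁻¹' U ∧ ∃ t : ∀ x, L x,
      SmoothSectionOn (E := E) V t ∧ (∀ y ∈ V, t y ≠ 0) ∧
      ∀ y ∈ V, ∀ a : TangentSpace 𝓘(ℝ, E) y, frameForm Q.cov t y a
        = frameForm Q.cov s (Φ y) (mfderiv 𝓘(ℝ, E) 𝓘(ℝ, E) Φ y a) := by
  have : CompleteSpace E := FiniteDimensional.complete ℝ E
  obtain ⟨e, he, hxe, hsub, hconv⟩ := exists_convex_chart (E := E) (Filter.inter_mem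
    ((hU.preimage Φ.continuous).mem_nhds hx) (baseSet_mem_nhds (L := L) x))
  set e₀ : ∀ y, L y := fun y => (trivializationAt ℂ L x).symm y (1 : ℂ) with he₀
  have hs₀ : SmoothSectionOn (E := E) e.source e₀ :=
    smoothSectionOn_of_forall fun y hy => smoothSectionAt_symm_one (hsub hy).2
  have hne₀ : ∀ y ∈ e.source, e₀ y ≠ 0 := fun y hy => symm_one_ne_zero (hsub hy).2
  set e₂ := chartTransport Φ e with he₂
  have hsm₂ : IsSmoothChart e₂ := he.chartTransport
  have hsub₂ : e₂.source ⊆ U := fun y hy => by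
    have h1 : Φ (Φ.symm y) ∈ U := (hsub (show Φ.symm y ∈ e.source from hy)).1
    rwa [Φ.apply_symm_apply] at h1
  have hs₂ : SmoothSectionOn (E := E) e₂.source s := ContMDiffOn.mono hs hsub₂
  have hne₂ : ∀ y ∈ e₂.source, s y ≠ 0 := fun y hy => h0 y (hsub₂ hy)
  have hω₀ := contDiffOn_coordForm Q.cov_smooth he hs₀ hne₀
  have hω₂ : ContDiffOn ℝ ∞ (coordForm Q.cov e₂ s) e.target :=
    contDiffOn_coordForm Q.cov_smooth hsm₂ hs₂ hne₂
  -- In these coordinates the two connection forms have exterior derivatives `Φ^*Ω` and `Ω`, which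
  -- agree, so their difference is closed.
  obtain ⟨f, hf, hfd⟩ := exists_contDiffOn_primitive hconv e.open_target (hω₂.sub hω₀) (by
    intro z hz u v
    obtain ⟨y, hy, rfl⟩ : ∃ y ∈ e.source, e y = z := ⟨_, e.map_target hz, e.right_inv hz⟩
    have d₀ := (hω₀.contDiffAt (e.open_target.mem_nhds hz)).differentiableAt (by simp)
    have d₂ := (hω₂.contDiffAt (e.open_target.mem_nhds hz)).differentiableAt (by simp)
    have c₀ := fderiv_coordForm_sub Q he hs₀ hne₀ hy u v
    have c₂ := fderiv_coordForm_sub Q hsm₂ hs₂ hne₂ (mem_chartTransport_source hy) u v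
    rw [he₂, he.coordField_chartTransport hy, he.coordField_chartTransport hy, hΦ,
      chartTransport_apply, ← c₀] at c₂
    change fderiv ℝ (coordForm Q.cov e₂ s - coordForm Q.cov e e₀) (e y) u v
      = fderiv ℝ (coordForm Q.cov e₂ s - coordForm Q.cov e e₀) (e y) v u
    rw [fderiv_sub d₂ d₀]
    simp only [_root_.sub_apply]
    linear_combination c₂)
  have hg : ∀ y ∈ e.source, ContMDiffAt 𝓘(ℝ, E) 𝓘(ℝ, ℂ) ∞
      (fun y => Complex.exp (Complex.I * f (e y))) y := fun y hy => by
    have h1 : ContDiffAt ℝ ∞ (fun z => Complex.exp (Complex.I * f z)) (e y) :=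
      (contDiffAt_const.mul (hf.contDiffAt (e.open_target.mem_nhds (e.map_source hy)))).cexp
    exact h1.contMDiffAt.comp y (he.contMDiffAt hy)
  -- Multiplying a frame by `exp(if)` adds `df` to its connection form. Here `f` is complex-valued,
  -- so the factor need not be unitary; a trivialization cover only asks for nonvanishing frames.
  set t : ∀ y, L y := fun y => Complex.exp (Complex.I * f (e y)) • e₀ y with ht
  have hne : ∀ y ∈ e.source, t y ≠ 0 := fun y hy =>
    smul_ne_zero (Complex.exp_ne_zero _) (hne₀ y hy)
  refine ⟨e.source, e.open_source, hxe, fun y hy => (hsub hy).1,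
    t, smoothSectionOn_of_forall fun y hy =>
      (hs₀.smoothSectionAt e.open_source hy).smul (hg y hy), hne, fun y hy a => ?_⟩
  have hc : IsComplexLinear Q.cov := Q.cov_complex
  have hlz := hc.leibniz (hs₀.smoothSectionAt e.open_source hy) (hg y hy) a
  rw [show (fun y => Complex.exp (Complex.I * f (e y)) • e₀ y) = t from rfl,
    cov_eq_frameForm_smul (hne y hy), cov_eq_frameForm_smul (hne₀ y hy)] at hlz
  set v : E := mfderiv 𝓘(ℝ, E) 𝓘(ℝ, E) e y a with hv
  have hd : mvfderiv 𝓘(ℝ, E) (fun y => Complex.exp (Complex.I * f (e y))) y a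
      = Complex.exp (Complex.I * f (e y)) * (Complex.I *
        (coordForm Q.cov e₂ s (e y) v - coordForm Q.cov e e₀ (e y) v)) := by
    have h1 : HasFDerivAt (fun z => Complex.exp (Complex.I * f z))
        (Complex.exp (Complex.I * f (e y)) • (Complex.I •
          (coordForm Q.cov e₂ s (e y) - coordForm Q.cov e e₀ (e y)))) (e y) :=
      ((hfd (e y) (e.map_source hy)).const_smul Complex.I).cexp
    rw [mvfderiv_comp_apply' (h := fun z => Complex.exp (Complex.I * f z))
      h1.differentiableAt.mdifferentiableAt ((he.contMDiffAt hy).mdifferentiableAt (by simp))]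
    have h2 : mvfderiv 𝓘(ℝ, E) (fun z => Complex.exp (Complex.I * f z)) (e y)
        (mfderiv 𝓘(ℝ, E) 𝓘(ℝ, E) e y a)
        = (mfderiv 𝓘(ℝ, E) 𝓘(ℝ, ℂ) (fun z => Complex.exp (Complex.I * f z)) (e y) :
          E →L[ℝ] ℂ) v := rfl
    rw [h2, mfderiv_eq_fderiv, h1.fderiv]
    rfl
  have hva : coordField e v y = a := he.coordField_mfderiv hy a
  have hform₂ : coordForm Q.cov e₂ s (e y) v
      = frameForm Q.cov s (Φ y) (mfderiv 𝓘(ℝ, E) 𝓘(ℝ, E) Φ y a) := by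
    have h1 := coordForm_apply_chart (cov := Q.cov) hsm₂ s (mem_chartTransport_source hy) v
    rw [he₂, he.coordField_chartTransport hy, chartTransport_apply, hva] at h1
    exact h1
  have hform₀ : coordForm Q.cov e e₀ (e y) v = frameForm Q.cov e₀ y a := by
    rw [coordForm_apply_chart he e₀ hy, hva]
  rw [hd, hform₂, hform₀, show t y = Complex.exp (Complex.I * f (e y)) • e₀ y from rfl, smul_smul, smul_smul, ← add_smul] at hlz
  have h3 := smul_left_injective ℂ (hne₀ y hy) hlz
  have h4 : (Complex.I * Complex.exp (Complex.I * f (e y))) *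
      frameForm Q.cov t y a
      = (Complex.I * Complex.exp (Complex.I * f (e y))) *
        frameForm Q.cov s (Φ y) (mfderiv 𝓘(ℝ, E) 𝓘(ℝ, E) Φ y a) := by
    linear_combination h3
  exact mul_left_cancel₀ (mul_ne_zero Complex.I_ne_zero (Complex.exp_ne_zero _)) h4

end LocalFrames

/-! ### Functions with vanishing derivative are locally constant -/

section LocallyConstant

variable {E : Type v} [NormedAddCommGroup E] [NormedSpace ℝ E] [CompleteSpace E]
  {M : Type u} [TopologicalSpace M] [ChartedSpace E M] [IsManifold 𝓘(ℝ, E) ∞ M]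

theorem eventually_eq_of_mvfderiv_eq_zero {W : Set M} (hW : IsOpen W) {h : M → ℂ}
    (hd : ∀ y ∈ W, MDifferentiableAt 𝓘(ℝ, E) 𝓘(ℝ, ℂ) h y)
    (h0 : ∀ y ∈ W, ∀ a : TangentSpace 𝓘(ℝ, E) y, mvfderiv 𝓘(ℝ, E) h y a = 0) {x : M}
    (hx : x ∈ W) : ∀ᶠ y in 𝓝 x, h y = h x := by
  obtain ⟨e, he, hxe, hsub, hconv⟩ := exists_convex_chart (E := E) (hW.mem_nhds hx)
  have hfd : ∀ z ∈ e.target, HasFDerivAt (h ∘ e.symm) (0 : E →L[ℝ] ℂ) z := fun z hz => by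
    have h1 := hd _ (hsub (e.map_target hz))
    have h2 := (he.contMDiffAt_symm hz).mdifferentiableAt (n := ∞) (by simp)
    have h3 : MDifferentiableAt 𝓘(ℝ, E) 𝓘(ℝ, ℂ) (h ∘ e.symm) z := h1.comp z h2
    have h4 : mfderiv 𝓘(ℝ, E) 𝓘(ℝ, ℂ) (h ∘ e.symm) z = (0 : E →L[ℝ] ℂ) := by
      ext a
      have h5 := mvfderiv_comp_apply' h1 h2 a
      rw [h0 _ (hsub (e.map_target hz))] at h5
      exact h5
    have h6 := h3.differentiableAt.hasFDerivAt
    rw [← mfderiv_eq_fderiv, h4] at h6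
    exact h6
  filter_upwards [e.open_source.mem_nhds hxe] with y hy
  have h7 := hconv.is_const_of_fderivWithin_eq_zero (𝕜 := ℝ) (f := h ∘ e.symm)
    (fun z hz => (hfd z hz).differentiableAt.differentiableWithinAt)
    (fun z hz => by
      rw [fderivWithin_of_isOpen e.open_target hz]
      exact (hfd z hz).fderiv) (e.map_source hy) (e.map_source hxe)
  simpa [e.left_inv hy, e.left_inv hxe] using h7

end LocallyConstant

/-! ### Transition functions and connection forms -/

section Gluing

variable {E : Type v} [NormedAddCommGroup E] [NormedSpace ℝ E]
  {M : Type u} [TopologicalSpace M] [ChartedSpace E M]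
  {Φ : M ≃ₘ^∞⟮𝓘(ℝ, E), 𝓘(ℝ, E)⟯ M}
  {L : M → Type w} [TopologicalSpace (TotalSpace ℂ L)]
  [∀ x, TopologicalSpace (L x)] [∀ x, AddCommGroup (L x)] [∀ x, Module ℂ (L x)]
  [∀ x, IsTopologicalAddGroup (L x)] [∀ x, ContinuousSMul ℝ (L x)]
  [FiberBundle ℂ L] [VectorBundle ℂ ℂ L]
  {cov : CovariantDerivative 𝓘(ℝ, E) ℂ L}

theorem SmoothSectionAt.eventually_ratio_smul {s s' : ∀ x, L x} {x : M}
    (hs' : SmoothSectionAt E s' x) (h0' : s' x ≠ 0) :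
    ∀ᶠ y in 𝓝 x, s y = ratio (s y) (s' y) • s' y := by
  filter_upwards [SmoothAlongAt.eventually_ne_zero hs' h0'] with y hy
  exact (ratio_smul_self _ hy).symm

/-- The logarithmic derivative of a transition function is the difference of the connection
forms. -/
theorem mvfderiv_ratio (hc : IsComplexLinear cov) {s s' : ∀ x, L x} {x : M}
    (hs : SmoothSectionAt E s x) (hs' : SmoothSectionAt E s' x) (h0 : s x ≠ 0) (h0' : s' x ≠ 0)
    (a : TangentSpace 𝓘(ℝ, E) x) :
    mvfderiv 𝓘(ℝ, E) (fun y => ratio (s y) (s' y)) x a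
      = Complex.I * (frameForm cov s x a - frameForm cov s' x a) * ratio (s x) (s' x) := by
  have hr : ContMDiffAt 𝓘(ℝ, E) 𝓘(ℝ, ℂ) ∞ (fun y => ratio (s y) (s' y)) x :=
    SmoothAlongAt.ratio hs hs' h0'
  have h1 := hc.leibniz hs' hr a
  rw [← cov_congr (SmoothAlongAt.smul hs' hr) (hs'.eventually_ratio_smul h0'),
    cov_eq_frameForm_smul h0, cov_eq_frameForm_smul h0'] at h1
  have h2 : (Complex.I * frameForm cov s x a * ratio (s x) (s' x)) • s' x
      = (ratio (s x) (s' x) * (Complex.I * frameForm cov s' x a)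
        + mvfderiv 𝓘(ℝ, E) (fun y => ratio (s y) (s' y)) x a) • s' x := by
    rw [mul_smul, ratio_smul_self _ h0', h1]
    module
  have h3 := smul_left_injective ℂ h0' h2
  linear_combination -h3

theorem mvfderiv_ratio_comp (hc : IsComplexLinear cov) {s s' : ∀ x, L x} {x : M}
    (hs : SmoothSectionAt E s (Φ x)) (hs' : SmoothSectionAt E s' (Φ x)) (h0 : s (Φ x) ≠ 0)
    (h0' : s' (Φ x) ≠ 0) (a : TangentSpace 𝓘(ℝ, E) x) :
    mvfderiv 𝓘(ℝ, E) (fun y => ratio (s (Φ y)) (s' (Φ y))) x a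
      = Complex.I * (frameForm cov s (Φ x) (mfderiv 𝓘(ℝ, E) 𝓘(ℝ, E) Φ x a)
        - frameForm cov s' (Φ x) (mfderiv 𝓘(ℝ, E) 𝓘(ℝ, E) Φ x a))
        * ratio (s (Φ x)) (s' (Φ x)) := by
  rw [← mvfderiv_ratio hc hs hs' h0 h0']
  exact mvfderiv_comp_apply' (h := fun y => ratio (s y) (s' y))
    ((SmoothAlongAt.ratio hs hs' h0').mdifferentiableAt (by simp))
    (Φ.contMDiff.mdifferentiable (by simp) x) a

theorem contMDiffAt_ratio_comp {s s' : ∀ x, L x} {x : M} (hs : SmoothSectionAt E s (Φ x))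
    (hs' : SmoothSectionAt E s' (Φ x)) (h0' : s' (Φ x) ≠ 0) :
    ContMDiffAt 𝓘(ℝ, E) 𝓘(ℝ, ℂ) ∞ (fun y => ratio (s (Φ y)) (s' (Φ y))) x :=
  SmoothAlongAt.ratio (hs.comp (Φ.contMDiff x)) (hs'.comp (Φ.contMDiff x)) h0'

/-- Suppose that the connection forms of the frames `t, t'` are the pullbacks of those of `s, s'`.
Then the quotient of the transition functions is locally constant. -/
theorem eventually_ratio_div_ratio_eq [CompleteSpace E] [IsManifold 𝓘(ℝ, E) ∞ M] (hc : IsComplexLinear cov)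
    {s s' t t' : ∀ x, L x} {W : Set M} (hW : IsOpen W)
    (hs : ∀ y ∈ W, SmoothSectionAt E s (Φ y) ∧ s (Φ y) ≠ 0)
    (hs' : ∀ y ∈ W, SmoothSectionAt E s' (Φ y) ∧ s' (Φ y) ≠ 0)
    (ht : ∀ y ∈ W, SmoothSectionAt E t y ∧ t y ≠ 0)
    (ht' : ∀ y ∈ W, SmoothSectionAt E t' y ∧ t' y ≠ 0)
    (hst : ∀ y ∈ W, ∀ a : TangentSpace 𝓘(ℝ, E) y, frameForm cov t y a
      = frameForm cov s (Φ y) (mfderiv 𝓘(ℝ, E) 𝓘(ℝ, E) Φ y a))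
    (hst' : ∀ y ∈ W, ∀ a : TangentSpace 𝓘(ℝ, E) y, frameForm cov t' y a
      = frameForm cov s' (Φ y) (mfderiv 𝓘(ℝ, E) 𝓘(ℝ, E) Φ y a)) {x : M} (hx : x ∈ W) :
    ∀ᶠ y in 𝓝 x, ratio (t y) (t' y) / ratio (s (Φ y)) (s' (Φ y))
      = ratio (t x) (t' x) / ratio (s (Φ x)) (s' (Φ x)) := by
  set h : M → ℂ := fun y => ratio (t y) (t' y) / ratio (s (Φ y)) (s' (Φ y)) with hh
  have hμ : ∀ y ∈ W, ContMDiffAt 𝓘(ℝ, E) 𝓘(ℝ, ℂ) ∞ (fun y => ratio (t y) (t' y)) y :=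
    fun y hy => SmoothAlongAt.ratio (ht y hy).1 (ht' y hy).1 (ht' y hy).2
  have hν : ∀ y ∈ W, ContMDiffAt 𝓘(ℝ, E) 𝓘(ℝ, ℂ) ∞ (fun y => ratio (s (Φ y)) (s' (Φ y))) y :=
    fun y hy => contMDiffAt_ratio_comp (hs y hy).1 (hs' y hy).1 (hs' y hy).2
  have hν0 : ∀ y ∈ W, ratio (s (Φ y)) (s' (Φ y)) ≠ 0 := fun y hy =>
    ratio_ne_zero (hs y hy).2 (hs' y hy).2
  have hsm : ∀ y ∈ W, MDifferentiableAt 𝓘(ℝ, E) 𝓘(ℝ, ℂ) h y := fun y hy =>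
    (contMDiffAt_div_complex (hμ y hy) (hν y hy) (hν0 y hy)).mdifferentiableAt (by simp)
  refine eventually_eq_of_mvfderiv_eq_zero hW (h := h) hsm (fun y hy a => ?_) hx
  -- Both `ratio t t'` and `ratio s s' ∘ Φ` have logarithmic derivative `i` times the same
  -- difference of forms. The product rule for the first as `h` times the second leaves `dh = 0`.
  have hprod : (fun y => ratio (t y) (t' y)) =ᶠ[𝓝 y]
      fun y => h y * ratio (s (Φ y)) (s' (Φ y)) := by
    filter_upwards [hW.mem_nhds hy] with z hz
    exact (div_mul_cancel₀ _ (hν0 z hz)).symm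
  have e1 : mvfderiv 𝓘(ℝ, E) (fun y => ratio (t y) (t' y)) y a
      = mvfderiv 𝓘(ℝ, E) (fun y => h y * ratio (s (Φ y)) (s' (Φ y))) y a := by
    rw [mvfderiv_congr hprod]
  rw [mvfderiv_mul_complex (hsm y hy) ((hν y hy).mdifferentiableAt (by simp)),
    mvfderiv_ratio hc (ht y hy).1 (ht' y hy).1 (ht y hy).2 (ht' y hy).2,
    mvfderiv_ratio_comp hc (hs y hy).1 (hs' y hy).1 (hs y hy).2 (hs' y hy).2,
    hst y hy, hst' y hy, hprod.eq_of_nhds] at e1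
  have e2 : mvfderiv 𝓘(ℝ, E) h y a * ratio (s (Φ y)) (s' (Φ y)) = 0 := by
    linear_combination -e1
  exact (mul_eq_zero.1 e2).resolve_right (hν0 y hy)

end Gluing

/-! ### Existence of trivialization covers and of complementary ones -/

section Complementary

variable {E : Type v} [NormedAddCommGroup E] [NormedSpace ℝ E]
  {M : Type u} [TopologicalSpace M] [ChartedSpace E M] [IsManifold 𝓘(ℝ, E) ∞ M]
  {Φ : M ≃ₘ^∞⟮𝓘(ℝ, E), 𝓘(ℝ, E)⟯ M}
  {L : M → Type w} [TopologicalSpace (TotalSpace ℂ L)]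
  [∀ x, TopologicalSpace (L x)] [∀ x, AddCommGroup (L x)] [∀ x, Module ℂ (L x)]
  [∀ x, IsTopologicalAddGroup (L x)] [∀ x, ContinuousSMul ℝ (L x)]
  [FiberBundle ℂ L] [VectorBundle ℂ ℂ L] [VectorBundle ℝ ℂ L]
  [ContMDiffVectorBundle ∞ ℂ L 𝓘(ℝ, E)]

variable (E M L) in
theorem nonempty_trivializationCover : Nonempty (TrivializationCover E L M) :=
  ⟨{ U := fun x => ⟨(trivializationAt ℂ L x).baseSet, (trivializationAt ℂ L x).open_baseSet⟩
     cover := fun x => ⟨x, mem_baseSet_trivializationAt ℂ L x⟩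
     s := fun x y => (trivializationAt ℂ L x).symm y (1 : ℂ)
     smooth := fun _ => smoothSectionOn_of_forall fun _ hy => smoothSectionAt_symm_one hy
     ne_zero := fun _ _ hy => symm_one_ne_zero hy }⟩

variable [FiniteDimensional ℝ E] [T2Space M] {Ω : BilinField E M} {J : Type z}

/-- On some open cover there are frames with the pulled back connection forms, whose transition
functions are the pulled back ones. -/
theorem TrivializationCover.exists_compatible_frames (hM : CechH1Vanishes M)
    (Q : PrequantumStructure L Ω) (hΦ : IsSymplectomorphism Ω Φ) (T : TrivializationCover E L J) :
    ∃ (K : Type u) (W : K → TopologicalSpace.Opens M) (α : K → J) (t : K → ∀ x, L x),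
      (∀ x, ∃ k, x ∈ W k) ∧ (∀ k, ∀ x ∈ W k, Φ x ∈ T.U (α k)) ∧
      (∀ k, ∀ x ∈ W k, SmoothSectionAt E (t k) x ∧ t k x ≠ 0) ∧
      (∀ k, ∀ x ∈ W k, ∀ a : TangentSpace 𝓘(ℝ, E) x, frameForm Q.cov (t k) x a
        = frameForm Q.cov (T.s (α k)) (Φ x) (mfderiv 𝓘(ℝ, E) 𝓘(ℝ, E) Φ x a)) ∧
      ∀ k l x, x ∈ W k → x ∈ W l → t k x = T.transition (α k) (α l) (Φ x) • t l x := by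
  have : CompleteSpace E := FiniteDimensional.complete ℝ E
  have hc : IsComplexLinear Q.cov := Q.cov_complex
  -- The local frames are indexed by the points of `M`, not by `J`: each point needs its own small
  -- neighbourhood, and the index type must lie in the universe of `CechH1Vanishes`.
  choose α hα using fun p : M => T.cover (Φ p)
  choose V hV hpV hVU t ht ht0 hform using fun p : M =>
    exists_frame_pullback Q hΦ (T.U (α p)).isOpen (T.smooth (α p)) (T.ne_zero (α p)) (hα p)
  set VO : M → TopologicalSpace.Opens M := fun p => ⟨V p, hV p⟩ with hVO
  have hts : ∀ p, ∀ y ∈ V p, SmoothSectionAt E (t p) y ∧ t p y ≠ 0 := fun p y hy =>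
    ⟨(ht p).smoothSectionAt (hV p) hy, ht0 p y hy⟩
  have hTs : ∀ p, ∀ y ∈ V p, SmoothSectionAt E (T.s (α p)) (Φ y) ∧ T.s (α p) (Φ y) ≠ 0 :=
    fun p y hy => ⟨T.smoothSectionAt (hVU p hy), T.ne_zero _ _ (hVU p hy)⟩
  -- The defect between the actual transition functions and the pulled back ones. Both are
  -- multiplicative, so `h` is a cocycle, and it is locally constant because the connection forms
  -- match.
  set h : M → M → M → ℂ := fun p q y =>
    ratio (t p y) (t q y) / T.transition (α p) (α q) (Φ y) with hh
  have hT0 : ∀ p q y, y ∈ V p → y ∈ V q → T.transition (α p) (α q) (Φ y) ≠ 0 :=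
    fun p q y hp hq => ratio_ne_zero (hTs p y hp).2 (hTs q y hq).2
  have h0 : ∀ p q y, y ∈ V p → y ∈ V q → h p q y ≠ 0 := fun p q y hp hq =>
    div_ne_zero (ratio_ne_zero (hts p y hp).2 (hts q y hq).2) (hT0 p q y hp hq)
  have hloc : ∀ p q y, y ∈ V p → y ∈ V q → ∀ᶠ z in 𝓝 y, h p q z = h p q y :=
    fun p q y hp hq => eventually_ratio_div_ratio_eq hc ((hV p).inter (hV q))
      (fun z hz => hTs p z hz.1) (fun z hz => hTs q z hz.2) (fun z hz => hts p z hz.1)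
      (fun z hz => hts q z hz.2) (fun z hz => hform p z hz.1) (fun z hz => hform q z hz.2)
      ⟨hp, hq⟩
  let c : CechCocycle VO :=
    { toFun := fun p q => ⟨fun y => Units.mk0 (h p q y) (h0 p q y y.2.1 y.2.2), by
        rw [IsLocallyConstant.iff_eventually_eq]
        intro y
        filter_upwards [continuous_subtype_val.continuousAt.eventually
          (hloc p q y y.2.1 y.2.2)] with z hz
        exact Units.ext hz⟩
      cocycle := by
        intro p q r y hp hq hr
        refine Units.ext ?_
        change h p q y * h q r y = h p r y
        simp only [hh, TrivializationCover.transition]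
        rw [div_mul_div_comm, ratio_mul_ratio _ (hts q y hq).2 (hts r y hr).2,
          ratio_mul_ratio _ (hTs q y hq).2 (hTs r y hr).2] }
  obtain ⟨K, W, r, hr, hW, g, hg⟩ := hM M VO (fun x => ⟨x, hpV x⟩) c
  classical
  -- The cochain `g` is extended by zero, since sections are total functions; only its values on `W
  -- k` matter.
  let G : K → M → ℂ := fun k x => if hx : x ∈ W k then (g k ⟨x, hx⟩ : ℂ) else 0
  have hG : ∀ k x (hx : x ∈ W k), G k x = (g k ⟨x, hx⟩ : ℂ) := fun k x hx => dif_pos hx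
  have hG0 : ∀ k x, x ∈ W k → G k x ≠ 0 := fun k x hx => by
    rw [hG k x hx]
    exact Units.ne_zero _
  have hGloc : ∀ k x, x ∈ W k → ∀ᶠ y in 𝓝 x, G k y = G k x := fun k x hx => by
    have h1 := (IsLocallyConstant.iff_eventually_eq _).1 (g k).isLocallyConstant ⟨x, hx⟩
    have h2 : 𝓝 x = Filter.map Subtype.val (𝓝 (⟨x, hx⟩ : W k)) :=
      ((W k).isOpen.isOpenEmbedding_subtypeVal.map_nhds_eq ⟨x, hx⟩).symm
    rw [h2, Filter.eventually_map]
    filter_upwards [h1] with y hy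
    rw [hG k y y.2, hG k x hx]
    exact congrArg Units.val hy
  have hGsm : ∀ k x, x ∈ W k → SmoothSectionAt E (fun y => G k y • t (r k) y) x :=
    fun k x hx => SmoothAlongAt.smul (hts (r k) x (hr k hx)).1
      (contMDiffAt_const.congr_of_eventuallyEq (hGloc k x hx))
  refine ⟨K, W, fun k => α (r k), fun k y => G k y • t (r k) y, hW,
    fun k x hx => hVU (r k) (hr k hx), fun k x hx => ⟨hGsm k x hx,
      smul_ne_zero (hG0 k x hx) (hts (r k) x (hr k hx)).2⟩, fun k x hx a => ?_,
    fun k l x hk hl => ?_⟩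
  · have hx' := hr k hx
    rw [← hform (r k) x hx' a]
    -- Near `x` the factor `G k` is constant, so it comes out of `∇` and leaves the connection form
    -- unchanged.
    have h1 : Q.cov (fun y => G k y • t (r k) y) x a = G k x • Q.cov (t (r k)) x a := by
      have h2 := hts (r k) x hx'
      rw [cov_congr (σ := fun y => G k x • t (r k) y) (SmoothAlongAt.smul h2.1 contMDiffAt_const)
        (by filter_upwards [hGloc k x hx] with y hy; rw [hy])]
      exact hc _ _ _ h2.1.mdifferentiableAt a
    have hne := smul_ne_zero (hG0 k x hx) (hts (r k) x hx').2
    have h3 := cov_eq_frameForm_smul (cov := Q.cov) (s := fun y => G k y • t (r k) y) hne a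
    rw [h1, cov_eq_frameForm_smul (hts (r k) x hx').2, smul_comm] at h3
    exact (mul_left_cancel₀ Complex.I_ne_zero (smul_left_injective ℂ hne h3)).symm
  · have hk' := hr k hk
    have hl' := hr l hl
    -- The coboundary relation `h = G l / G k` is the one for which the rescaled frames `G k • t (r
    -- k)` have transition functions exactly `Φ^*λ`.
    have h1 : h (r k) (r l) x = G l x / G k x := by
      rw [hG k x hk, hG l x hl, ← Units.val_div_eq_div_val]
      exact congrArg Units.val (hg k l x hk hl)
    have h2 : G k x * ratio (t (r k) x) (t (r l) x)
        = T.transition (α (r k)) (α (r l)) (Φ x) * G l x := by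
      have h3 := hT0 _ _ x hk' hl'
      have h4 := hG0 k x hk
      simp only [hh] at h1
      rw [div_eq_div_iff h3 h4] at h1
      linear_combination h1
    change G k x • t (r k) x = _ • G l x • t (r l) x
    rw [smul_smul, ← h2, mul_smul, ratio_smul_self _ (hts (r l) x hl').2]

/-- Over `Φ⁻¹(U_β)` the frame must be `Φ^*λ_{β α_k} t_k` on each `W_k`. The cocycle rule for `λ`
makes these expressions agree on overlaps, so they define one section. -/
theorem TrivializationCover.exists_isComplementary (hM : CechH1Vanishes M)
    (Q : PrequantumStructure L Ω) (hΦ : IsSymplectomorphism Ω Φ) (T : TrivializationCover E L J) :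
    ∃ T', T.IsComplementary Q.cov Φ T' := by
  have hc : IsComplexLinear Q.cov := Q.cov_complex
  obtain ⟨K, W, α, t, hW, hα, ht, hform, htr⟩ := T.exists_compatible_frames hM Q hΦ
  -- `κ` is an arbitrary pointwise choice without any continuity. By `key`, `σ` does not depend on
  -- it, so near a point `σ` may be computed with a fixed `k`.
  choose κ hκ using hW
  set σ : J → ∀ x, L x := fun β x => T.transition β (α (κ x)) (Φ x) • t (κ x) x with hσ
  have key : ∀ β k x, Φ x ∈ T.U β → x ∈ W k →
      σ β x = ratio (T.s β (Φ x)) (T.s (α k) (Φ x)) • t k x := by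
    intro β k x hβ hk
    have e := htr (κ x) k x (hκ x) hk
    simp only [hσ]
    rw [e, smul_smul, transition, transition, ratio_mul_ratio _
      (T.ne_zero _ _ (hα _ _ (hκ x))) (T.ne_zero _ _ (hα k x hk))]
  have hnhds : ∀ β x, Φ x ∈ T.U β → ∀ k, x ∈ W k → ∀ᶠ y in 𝓝 x, Φ y ∈ T.U β ∧ y ∈ W k :=
    fun β x hβ k hk => (Φ.continuous.continuousAt.eventually ((T.U β).isOpen.mem_nhds hβ)).and
      ((W k).isOpen.mem_nhds hk)
  have hsm : ∀ β x, Φ x ∈ T.U β → SmoothSectionAt E (σ β) x := by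
    intro β x hβ
    have hk := hκ x
    refine SmoothAlongAt.congr ((ht _ x hk).1.smul (contMDiffAt_ratio_comp
      (T.smoothSectionAt hβ) (T.smoothSectionAt (hα _ x hk)) (T.ne_zero _ _ (hα _ x hk)))) ?_
    filter_upwards [hnhds β x hβ _ hk] with y hy
    exact key β _ y hy.1 hy.2
  have hne : ∀ β x, Φ x ∈ T.U β → σ β x ≠ 0 := fun β x hβ =>
    smul_ne_zero (ratio_ne_zero (T.ne_zero _ _ hβ) (T.ne_zero _ _ (hα _ x (hκ x))))
      (ht _ x (hκ x)).2
  refine ⟨{ U := fun β => ⟨Φ ⁻¹' (T.U β : Set M), (T.U β).isOpen.preimage Φ.continuous⟩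
            cover := fun x => T.cover (Φ x)
            s := σ
            smooth := fun β => smoothSectionOn_of_forall fun x hx => hsm β x hx
            ne_zero := fun β x hx => hne β x hx }, fun β => rfl, ?_, ?_⟩
  · intro β γ x hβ hγ
    have hk := hα _ x (hκ x)
    refine ((eq_ratio_iff (hne γ x hγ) _).2 ?_).symm
    change σ β x = T.transition β γ (Φ x) • σ γ x
    rw [key β _ x hβ (hκ x), key γ _ x hγ (hκ x), smul_smul, transition,
      ratio_mul_ratio _ (T.ne_zero _ _ hγ) (T.ne_zero _ _ hk)]
  · intro β x hβ a
    have hk := hκ x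
    have hαk := hα _ x hk
    change frameForm Q.cov (σ β) x a
      = frameForm Q.cov (T.s β) (Φ x) (mfderiv 𝓘(ℝ, E) 𝓘(ℝ, E) Φ x a)
    -- The functions `σ β / t_k` and `(s_β / s_{α_k}) ∘ Φ` coincide near `x`. Comparing logarithmic
    -- derivatives and using that `t_k` has the form of `s_{α_k}` pulled back gives the same for `σ
    -- β`.
    have e1 := mvfderiv_ratio hc (hsm β x hβ) (ht _ x hk).1 (hne β x hβ) (ht _ x hk).2 a
    have e2 := mvfderiv_ratio_comp (Φ := Φ) hc (T.smoothSectionAt hβ) (T.smoothSectionAt hαk)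
      (T.ne_zero _ _ hβ) (T.ne_zero _ _ hαk) a
    have hev : (fun y => ratio (σ β y) (t (κ x) y)) =ᶠ[𝓝 x]
        fun y => ratio (T.s β (Φ y)) (T.s (α (κ x)) (Φ y)) := by
      filter_upwards [hnhds β x hβ _ hk] with y hy
      rw [key β _ y hy.1 hy.2, ratio_smul _ (ht _ y hy.2).2]
    rw [mvfderiv_congr hev, e2, hev.eq_of_nhds, hform _ x hk a] at e1
    have e3 := mul_left_cancel₀ Complex.I_ne_zero (mul_right_cancel₀
      (ratio_ne_zero (T.ne_zero _ _ hβ) (T.ne_zero _ _ hαk)) e1)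
    linear_combination -e3

end Complementary

/-! ### Transport of leaves -/

section TransportLeaf

variable {E : Type v} [NormedAddCommGroup E] [NormedSpace ℝ E]
  {M : Type u} [TopologicalSpace M] [ChartedSpace E M] [IsManifold 𝓘(ℝ, E) ∞ M]
  {P : TangentDistribution E M} (Φ : M ≃ₘ^∞⟮𝓘(ℝ, E), 𝓘(ℝ, E)⟯ M)

theorem IntegralManifold.range_transport (N : IntegralManifold P) :
    range (N.transport Φ).ι = Φ.symm '' range N.ι := range_comp Φ.symm N.ι

/-- Every integral manifold of `Φ(P)` is of the form `Φ⁻¹ ∘ ι`. -/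
theorem IntegralManifold.exists_transport_eq [CompleteSpace E]
    (N' : IntegralManifold (GeomQuant.transport Φ P)) :
    ∃ N : IntegralManifold P, N.transport Φ = N' := by
  let N₀ := N'.transport Φ.symm
  refine ⟨{ dim := N₀.dim
            B := N₀.B
            ι := N₀.ι
            smooth := N₀.smooth
            injective := N₀.injective
            immersion := N₀.immersion
            tangent := fun b => (N₀.tangent b).trans
              (congrFun (transport_symm_transport Φ P) _) }, ?_⟩
  have h : (Φ.symm ∘ Φ ∘ N'.ι : N'.B → M) = N'.ι :=
    funext fun b => Φ.symm_apply_apply _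
  -- Both structures have the same `dim` and `B` with its manifold structure; only the maps `Φ.symm
  -- ∘ Φ ∘ ι` and `ι` have to be identified.
  cases N'
  change IntegralManifold.mk _ _ (Φ.symm ∘ Φ ∘ _) _ _ _ _ = _
  congr 1

/-- Every competitor in the maximality condition for `Φ(P)` is a transported one, and transport
keeps the manifold `B`, so the same map `F` gives the factorization on both sides. -/
theorem IntegralManifold.isLeaf_transport_iff [CompleteSpace E] (N : IntegralManifold P) :
    (N.transport Φ).IsLeaf ↔ N.IsLeaf := by
  have hmeet : ∀ N' : IntegralManifold P,
      (range (N'.transport Φ).ι ∩ range (N.transport Φ).ι).Nonempty ↔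
        (range N'.ι ∩ range N.ι).Nonempty := fun N' => by
    rw [range_transport, range_transport, ← image_inter (EquivLike.injective Φ.symm),
      image_nonempty]
  constructor
  · intro h N' hN'
    obtain ⟨F, hF, hs, e⟩ := h (N'.transport Φ) ((hmeet N').2 hN')
    exact ⟨F, hF, hs, funext fun b => Φ.symm.injective (congrFun e b)⟩
  · intro h N'' hN''
    obtain ⟨N', rfl⟩ := N''.exists_transport_eq Φ
    obtain ⟨F, hF, hs, e⟩ := h N' ((hmeet N').1 hN'')
    exact ⟨F, hF, hs, funext fun b => congrArg Φ.symm (congrFun e b)⟩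

variable (P) in
/-- The bijection `B ↦ Φ(B)` from the leaves of `P` to the leaves of `Φ(P)`. -/
def Leaf.transportEquiv [CompleteSpace E] : Leaf P ≃ Leaf (GeomQuant.transport Φ P) where
  toFun ℓ := ⟨Φ.symm '' ℓ.1, by
    obtain ⟨N, hN, e⟩ := ℓ.2
    exact ⟨N.transport Φ, (N.isLeaf_transport_iff Φ).2 hN, by rw [N.range_transport, e]⟩⟩
  invFun ℓ := ⟨Φ '' ℓ.1, by
    obtain ⟨N', hN, e⟩ := ℓ.2
    obtain ⟨N, rfl⟩ := N'.exists_transport_eq Φ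
    refine ⟨N, (N.isLeaf_transport_iff Φ).1 hN, ?_⟩
    rw [← e, N.range_transport, ← image_comp]
    simp⟩
  left_inv ℓ := Subtype.ext (by
    change Φ '' (Φ.symm '' ℓ.1) = ℓ.1
    rw [← image_comp]
    simp)
  right_inv ℓ := Subtype.ext (by
    change Φ.symm '' (Φ '' ℓ.1) = ℓ.1
    rw [← image_comp]
    simp)

theorem Leaf.range_transport_eq [CompleteSpace E] (ℓ : Leaf P) (N : IntegralManifold P)
    (hN : range N.ι = ℓ.1) : range (N.transport Φ).ι = (Leaf.transportEquiv P Φ ℓ).1 := by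
  rw [N.range_transport, hN]
  rfl

/-- The representative chosen for `Φ(ℓ)` need not be the transport of the one chosen for `ℓ`. Both
are leaves with the same image, so maximality makes them diffeomorphic over `M`. -/
theorem Leaf.exists_diffeomorph_transportEquiv [CompleteSpace E] (ℓ : Leaf P) :
    ∃ G : (Leaf.transportEquiv P Φ ℓ).rep.B ≃ₘ^∞⟮𝓡 (Leaf.transportEquiv P Φ ℓ).rep.dim,
        𝓡 ℓ.rep.dim⟯ ℓ.rep.B,
      ∀ b', Φ ((Leaf.transportEquiv P Φ ℓ).rep.ι b') = ℓ.rep.ι (G b') := by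
  obtain ⟨G, hG⟩ := ((ℓ.rep.isLeaf_transport_iff Φ).2 ℓ.rep_isLeaf).exists_diffeomorph
    (Leaf.transportEquiv P Φ ℓ).rep_isLeaf
    ((Leaf.range_rep _).trans (ℓ.range_transport_eq Φ ℓ.rep ℓ.range_rep).symm)
  refine ⟨G, fun b' => ?_⟩
  rw [← congrFun hG b']
  exact Φ.apply_symm_apply _

end TransportLeaf

/-! ### Isomorphisms of Bohr-Sommerfeld quantizations -/

section Quantization

variable {E : Type v} [NormedAddCommGroup E] [NormedSpace ℝ E]
  {M : Type u} [TopologicalSpace M] [ChartedSpace E M] [IsManifold 𝓘(ℝ, E) ∞ M]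
  {L : M → Type w} [TopologicalSpace (TotalSpace ℂ L)]
  [∀ x, TopologicalSpace (L x)] [∀ x, AddCommGroup (L x)] [∀ x, Module ℂ (L x)]
  [∀ x, IsTopologicalAddGroup (L x)] [∀ x, ContinuousSMul ℝ (L x)]
  [FiberBundle ℂ L] [VectorBundle ℂ ℂ L] [VectorBundle ℝ ℂ L]
  [ContMDiffVectorBundle ∞ ℂ L 𝓘(ℝ, E)] [CompleteSpace E]
  {P : TangentDistribution E M} {Φ : M ≃ₘ^∞⟮𝓘(ℝ, E), 𝓘(ℝ, E)⟯ M}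
  {cov : CovariantDerivative 𝓘(ℝ, E) ℂ L} {J : Type z} {T T' : TrivializationCover E L J}

theorem TrivializationCover.IsComplementary.exists_H0_transport_equiv
    (hc : IsComplexLinear cov) (h : T.IsComplementary cov Φ T') (N : IntegralManifold P) :
    ∃ φ : N.H0 cov ≃ₗ[ℂ] (N.transport Φ).H0 cov,
      ∀ (τ : N.H0 cov) (α : J) (b : N.B), N.ι b ∈ T.U α → ∀ f : ℂ,
        τ.1 b = f • T.s α (N.ι b) → (φ τ).1 b = f • T'.s α ((N.transport Φ).ι b) :=
  ⟨h.parallelEquiv hc N.smooth (N.transport Φ).smooth (Diffeomorph.refl (𝓡 N.dim) N.B ∞)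
      fun b => Φ.apply_symm_apply (N.ι b),
    fun τ _ _ hα _ hτ => h.parallelEquiv_apply hc N.smooth (N.transport Φ).smooth
      (Diffeomorph.refl (𝓡 N.dim) N.B ∞) (fun b => Φ.apply_symm_apply (N.ι b)) τ hα hτ⟩

theorem TrivializationCover.IsComplementary.exists_H0_rep_equiv
    (hc : IsComplexLinear cov) (h : T.IsComplementary cov Φ T') (ℓ : Leaf P) :
    ∃ φ : ℓ.rep.H0 cov ≃ₗ[ℂ] (Leaf.transportEquiv P Φ ℓ).rep.H0 cov,
      ∀ (τ : ℓ.rep.H0 cov) (α : J) (b : ℓ.rep.B) (b' : (Leaf.transportEquiv P Φ ℓ).rep.B),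
        Φ ((Leaf.transportEquiv P Φ ℓ).rep.ι b') = ℓ.rep.ι b → ℓ.rep.ι b ∈ T.U α → ∀ f : ℂ,
          τ.1 b = f • T.s α (ℓ.rep.ι b) →
            (φ τ).1 b' = f • T'.s α ((Leaf.transportEquiv P Φ ℓ).rep.ι b') := by
  obtain ⟨G, hG⟩ := ℓ.exists_diffeomorph_transportEquiv Φ
  refine ⟨h.parallelEquiv hc ℓ.rep.smooth (Leaf.transportEquiv P Φ ℓ).rep.smooth G hG,
    fun τ α b b' hb hα f hτ => ?_⟩
  -- Since `ι` is injective, the point over `Φ (ι' b')` is unique, so the formula need not mention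
  -- `G`.
  obtain rfl : G b' = b := ℓ.rep.injective ((hG b').symm.trans hb)
  exact h.parallelEquiv_apply hc ℓ.rep.smooth (Leaf.transportEquiv P Φ ℓ).rep.smooth G hG τ hα hτ

end Quantization

/-- A bijection of index types and linear isomorphisms of the corresponding summands induce a
linear isomorphism of direct sums. -/
theorem exists_directSum_equiv {R ι κ : Type*} [Semiring R] [DecidableEq ι] [DecidableEq κ]
    {A : ι → Type*} {B : κ → Type*} [∀ i, AddCommMonoid (A i)] [∀ k, AddCommMonoid (B k)]
    [∀ i, Module R (A i)] [∀ k, Module R (B k)] (e : ι ≃ κ) (φ : ∀ i, A i ≃ₗ[R] B (e i)) :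
    ∃ Ψ : DirectSum ι A ≃ₗ[R] DirectSum κ B,
      ∀ i a, Ψ (DirectSum.lof R ι A i a) = DirectSum.lof R κ B (e i) (φ i a) := by
  -- Reindexing `B` along `e.symm` has summands `B (e i)` by definition, so its inverse composes
  -- with `φ` without transport between fibres.
  refine ⟨(DFinsupp.mapRange.linearEquiv φ).trans (DirectSum.lequivCongrLeft R e.symm).symm,
    fun i a => ?_⟩
  rw [LinearEquiv.trans_apply, DirectSum.lof_eq_of, DirectSum.of, DFinsupp.singleAddHom_apply,
    DFinsupp.mapRange.linearEquiv_apply, DFinsupp.mapRange_single]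
  exact DirectSum.lequivCongrLeft_symm_lof (R := R) (M := B) (h := e.symm) (k := i) (x := φ i a)

end GeomQuant

end

theorem theorem2 {E : Type v} [NormedAddCommGroup E] [NormedSpace ℝ E] [FiniteDimensional ℝ E]
    {M : Type u} [TopologicalSpace M] [ChartedSpace E M] [IsManifold 𝓘(ℝ, E) ∞ M]
    [T2Space M] [SecondCountableTopology M]
    {L : M → Type w} [TopologicalSpace (TotalSpace ℂ L)]
    [∀ x, TopologicalSpace (L x)] [∀ x, AddCommGroup (L x)] [∀ x, Module ℂ (L x)]
    [∀ x, IsTopologicalAddGroup (L x)] [∀ x, ContinuousSMul ℝ (L x)]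
    [FiberBundle ℂ L] [VectorBundle ℂ ℂ L] [VectorBundle ℝ ℂ L]
    [ContMDiffVectorBundle ∞ ℂ L 𝓘(ℝ, E)]
    (Ω : BilinField E M) (hΩ : IsSymplectic Ω) (Q : PrequantumStructure L Ω)
    (P : TangentDistribution E M) (hP : IsPolarization Ω P)
    (Φ : M ≃ₘ^∞⟮𝓘(ℝ, E), 𝓘(ℝ, E)⟯ M) (hΦ : IsSymplectomorphism Ω Φ)
    (hM : CechH1Vanishes M) :
    -- `Φ(P)` is again a polarization
    IsPolarization Ω (transport Φ P) ∧
    -- trivialization covers exist, and each of them has a complementary one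
    Nonempty (TrivializationCover E L M) ∧
    (∀ (J : Type u) (T : TrivializationCover E L J), ∃ T', T.IsComplementary Q.cov Φ T') ∧
    -- `ι` is a leaf of `P` if and only if `Φ⁻¹ ∘ ι` is a leaf of `Φ(P)`
    (∀ N : IntegralManifold P, (N.transport Φ).IsLeaf ↔ N.IsLeaf) ∧
    -- on each leaf, covariantly constant sections correspond by `f s_α ↦ f t_α`
    (∀ (J : Type u) (T T' : TrivializationCover E L J), T.IsComplementary Q.cov Φ T' →
      ∀ N : IntegralManifold P, N.IsLeaf →
        ∃ φ : N.H0 Q.cov ≃ₗ[ℂ] (N.transport Φ).H0 Q.cov,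
          ∀ (τ : N.H0 Q.cov) (α : J) (b : N.B), N.ι b ∈ T.U α → ∀ f : ℂ,
            τ.1 b = f • T.s α (N.ι b) →
              (φ τ).1 b = f • T'.s α ((N.transport Φ).ι b)) ∧
    -- the induced bijection of the sets of leaves preserves the Bohr-Sommerfeld property
    ∃ (e : Leaf P ≃ Leaf (transport Φ P))
      (he : ∀ ℓ, (e ℓ).IsBohrSommerfeld Q.cov ↔ ℓ.IsBohrSommerfeld Q.cov),
      (∀ (ℓ : Leaf P) (N : IntegralManifold P), N.IsLeaf → range N.ι = ℓ.1 →
        range (N.transport Φ).ι = (e ℓ).1) ∧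
      -- the isomorphism of Bohr-Sommerfeld quantizations, the direct sum of the isomorphisms
      -- of the summands of `B` and of `Φ(B)` given by `f s_α ↦ f t_α`
      ∀ (J : Type u) (T T' : TrivializationCover E L J), T.IsComplementary Q.cov Φ T' →
        ∃ φ : ∀ ℓ : Leaf P, ℓ.rep.H0 Q.cov ≃ₗ[ℂ] (e ℓ).rep.H0 Q.cov,
          (∀ (ℓ : Leaf P) (τ : ℓ.rep.H0 Q.cov) (α : J) (b : ℓ.rep.B) (b' : (e ℓ).rep.B),
            Φ ((e ℓ).rep.ι b') = ℓ.rep.ι b → ℓ.rep.ι b ∈ T.U α → ∀ f : ℂ,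
              τ.1 b = f • T.s α (ℓ.rep.ι b) →
                (φ ℓ τ).1 b' = f • T'.s α ((e ℓ).rep.ι b')) ∧
          ∃ Ψ : BSQuantization Q.cov P ≃ₗ[ℂ] BSQuantization Q.cov (transport Φ P),
            ∀ (ℓ : Leaf P) (hℓ : ℓ.IsBohrSommerfeld Q.cov) (τ : ℓ.rep.H0 Q.cov),
              Ψ (BSQuantization.summand Q.cov P ⟨ℓ, hℓ⟩ τ) =
                BSQuantization.summand Q.cov (transport Φ P) ⟨e ℓ, (he ℓ).2 hℓ⟩ (φ ℓ τ) := by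
  have hc : IsComplexLinear Q.cov := Q.cov_complex
  have : CompleteSpace E := FiniteDimensional.complete ℝ E
  have he : ∀ ℓ : Leaf P, (Leaf.transportEquiv P Φ ℓ).IsBohrSommerfeld Q.cov ↔
      ℓ.IsBohrSommerfeld Q.cov := fun ℓ => by
    -- The Bohr-Sommerfeld property involves no cover, so any one cover with a complementary one is
    -- enough to compare the two spaces.
    obtain ⟨T⟩ := nonempty_trivializationCover E M L
    obtain ⟨T', h⟩ := T.exists_isComplementary hM Q hΦ
    obtain ⟨φ, -⟩ := h.exists_H0_rep_equiv hc ℓ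
    rw [Leaf.IsBohrSommerfeld, Leaf.IsBohrSommerfeld, ← Submodule.nontrivial_iff_ne_bot,
      ← Submodule.nontrivial_iff_ne_bot]
    exact φ.symm.toEquiv.nontrivial_congr
  refine ⟨hP.transport hΦ, nonempty_trivializationCover E M L,
    fun J T => T.exists_isComplementary hM Q hΦ, fun N => N.isLeaf_transport_iff Φ,
    fun J T T' h N _ => h.exists_H0_transport_equiv hc N,
    Leaf.transportEquiv P Φ, he, fun ℓ N _ hN => ℓ.range_transport_eq Φ N hN,
    fun J T T' h => ?_⟩
  choose φ hφ using fun ℓ : Leaf P => h.exists_H0_rep_equiv hc ℓ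
  refine ⟨φ, hφ, ?_⟩
  classical
  obtain ⟨Ψ, hΨ⟩ := exists_directSum_equiv (R := ℂ)
    (A := fun ℓ : BSLeaf Q.cov P => ℓ.1.rep.H0 Q.cov)
    (B := fun ℓ : BSLeaf Q.cov (transport Φ P) => ℓ.1.rep.H0 Q.cov)
    ((Leaf.transportEquiv P Φ).subtypeEquiv fun ℓ => (he ℓ).symm) fun ℓ => φ ℓ.1
  exact ⟨Ψ, fun ℓ hℓ τ => hΨ ⟨ℓ, hℓ⟩ τ⟩
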